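/- Let $R$ be the hyperfinite $\mathrm{II}_1$ factor with its faithful normal tracial state $\tau$, write $\|a\|_2=\tau(a^*a)^{1/2}$, and let $L^2R$ be the completion of $R$ in $\|\cdot\|_2$ with its left and right multiplication actions of $R$. A central sequence of $R$ is a norm bounded sequence $(x_n)$ in $R$ with $\|x_nm-mx_n\|_2\to0$ for all $m\in R$. (1) Let $S$ be any factor, let $M=R\,\overline\otimes\,S$ be the von Neumann algebra tensor product, and let $H$ be a separable $M$-$M$ Hilbert bimodule (a separable Hilbert space with commuting normal unital $*$-representations of $M$ and of $M^{\mathrm{op}}$) such that $$\|(x_n\otimes 1_S)\xi-\xi(x_n\otimes 1_S)\|\to0$$ for every $\xi\in H$ and every central sequence $(x_n)$ of $R$. Then there is an $S$-$S$ Hilbert bimodule $K$ such that $H\cong L^2R\otimes K$ as $M$-$M$ bimodules, where $(r\otimes s)(v\otimes k)=rv\otimes sk$ and $(v\otimes k)(r\otimes s)=vr\otimes ks$ for $r\in R$, $s\in S$, $v\in L^2R$, $k\in K$. (2) In particular, $\tilde\chi(R)$ is trivial: an $R$-$R$ Hilbert bimodule $X$ is an object of $\tilde\chi(R)$ if and only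 if $X\cong\bigoplus_{i=1}^n L^2R$ as $R$-$R$ bimodules for some integer $n\ge0$. Here $X$ is an object of $\tilde\chi(R)$ if it is bifinite (finitely generated projective as a right and as a left $R$-module), and both $X$ and its conjugate $\overline X$ are centrally trivial and approximately inner. An $R$-$R$ bimodule $X$ is centrally trivial if $\|x_n\xi-\xi x_n\|\to0$ for every $\xi\in X$ and every central sequence $(x_n)$ of $R$. It is approximately inner if there are $m\in\mathbb N$ and right-bounded vectors $b_i^{(n)}\in X$ ($1\le i\le m$, $n\in\mathbb N$), i.e. vectors for which $\hat a\mapsto b_i^{(n)}a$ extends to a bounded operator $L_i^{(n)}\colon L^2R\to X$, such that $\sup_{i,n}\|L_i^{(n)}\|<\infty$, $\sum_{i=1}^m L_i^{(n)}(L_i^{(n)})^*x\to x$ as $n\to\infty$ for every $x\in X$, and $\|ab_i^{(n)}-b_i^{(n)}a\|\to0$ as $n\to\infty$ for every $a\in R$ and every $i$. -/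

import Mathlib

open Filter Topology MulOpposite
universe u v w w'

open scoped TensorProduct ComplexOrder

/-! ### Von Neumann algebras -/

namespace VonNeumannAlgebra

section Basic

variable {H : Type u} [NormedAddCommGroup H] [InnerProductSpace ℂ H] [CompleteSpace H]

instance : SMulMemClass (VonNeumannAlgebra H) ℂ (H →L[ℂ] H) where
  smul_mem {s} c _ hx := s.toStarSubalgebra.smul_mem hx c

instance isClosed_coe (M : VonNeumannAlgebra H) : IsClosed (M : Set (H →L[ℂ] H)) := by
  rw [← M.centralizer_centralizer]
  exact Set.isClosed_centralizer _

instance starOrderedRing (M : VonNeumannAlgebra H) : StarOrderedRing M := by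
  refine StarOrderedRing.of_nonneg_iff' (fun {x y} h z => add_le_add_right (α := H →L[ℂ] H) h z)
    (fun x => ⟨fun hx => ?_, ?_⟩)
  · have hx' : 0 ≤ (x : H →L[ℂ] H) := hx
    have hsa : IsSelfAdjoint x := Subtype.ext (IsSelfAdjoint.of_nonneg hx')
    have hcl : IsClosed (M.toStarSubalgebra : Set (H →L[ℂ] H)) := isClosed_coe M
    have hspec : spectrum ℂ x = spectrum ℂ (x : H →L[ℂ] H) :=
      StarSubalgebra.spectrum_eq M.toStarSubalgebra (hS := hcl) (a := x)
    have hnn : ∀ r ∈ spectrum ℝ x, 0 ≤ r := by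
      intro r hr
      have h1 : (algebraMap ℝ ℂ r) ∈ spectrum ℂ (x : H →L[ℂ] H) := by
        rw [← hspec]
        exact spectrum.algebraMap_mem ℂ hr
      have h2 : r ∈ spectrum ℝ (x : H →L[ℂ] H) := spectrum.of_algebraMap_mem ℂ h1
      exact spectrum_nonneg_of_nonneg hx' h2
    obtain ⟨s, hs, -, hss⟩ := CFC.exists_sqrt_of_isSelfAdjoint_of_quasispectrumRestricts hsa
      (SpectrumRestricts.nnreal_iff.mpr hnn)
    exact ⟨s, by rw [hs.star_eq, hss]⟩
  · rintro ⟨s, rfl⟩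
    exact star_mul_self_nonneg (s : H →L[ℂ] H)

/-- The von Neumann algebra `(s ∪ s*)''` generated by a set of bounded operators. -/
noncomputable def generatedBy (s : Set (H →L[ℂ] H)) : VonNeumannAlgebra H where
  toStarSubalgebra := StarSubalgebra.centralizer ℂ (StarSubalgebra.centralizer ℂ s : Set (H →L[ℂ] H))
  centralizer_centralizer' := by
    change Set.centralizer (Set.centralizer (StarSubalgebra.centralizer ℂ
      (StarSubalgebra.centralizer ℂ s : Set (H →L[ℂ] H)) : Set (H →L[ℂ] H))) = (StarSubalgebra.centralizer ℂ
      (StarSubalgebra.centralizer ℂ s : Set (H →L[ℂ] H)) : Set (H →L[ℂ] H))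
    rw [StarSubalgebra.coe_centralizer_centralizer, Set.centralizer_centralizer_centralizer]

theorem subset_generatedBy (s : Set (H →L[ℂ] H)) : s ⊆ generatedBy s := by
  change s ⊆ (StarSubalgebra.centralizer ℂ
      (StarSubalgebra.centralizer ℂ s : Set (H →L[ℂ] H)) : Set (H →L[ℂ] H))
  rw [StarSubalgebra.coe_centralizer_centralizer]
  exact Set.subset_union_left.trans Set.subset_centralizer_centralizer

/-- `M` is a factor: `M ≠ 0` and its centre consists of the scalars. -/
def IsFactor (M : VonNeumannAlgebra H) : Prop :=
  (1 : H →L[ℂ] H) ≠ 0 ∧ ∀ z ∈ M, (∀ y ∈ M, z * y = y * z) → ∃ c : ℂ, z = c • (1 : H →L[ℂ] H)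

/-- `φ` belongs to the predual of `M`, i.e. `φ` is ultraweakly continuous:
`φ a = ∑ i, ⟪ξ i, a (η i)⟫` for square summable sequences of vectors `ξ`, `η`. -/
def IsNormalFunctional (M : VonNeumannAlgebra H) (φ : M → ℂ) : Prop :=
  ∃ ξ η : ℕ → H, Summable (fun i => ‖ξ i‖ ^ 2) ∧ Summable (fun i => ‖η i‖ ^ 2) ∧
    ∀ a : M, HasSum (fun i => inner ℂ (ξ i) ((a : H →L[ℂ] H) (η i))) (φ a)

/-- A faithful normal tracial state on `M`. -/
structure TracialState (M : VonNeumannAlgebra H) where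
  toPositive : M →ₚ[ℂ] ℂ
  map_one : toPositive 1 = 1
  tracial : ∀ a b : M, toPositive (a * b) = toPositive (b * a)
  faithful : ∀ a : M, toPositive (star a * a) = 0 → a = 0
  normal : M.IsNormalFunctional toPositive

/-- `M` is a `II₁` factor: an infinite dimensional factor with a faithful normal tracial state
(which is then unique). -/
def IsII1Factor (M : VonNeumannAlgebra H) : Prop :=
  M.IsFactor ∧ ¬ FiniteDimensional ℂ M ∧ Nonempty M.TracialState

/-- `M` is the hyperfinite `II₁` factor: a `II₁` factor generated by an increasing sequence of
unital star subalgebras each of which is a full matrix algebra. -/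
def IsHyperfiniteII1Factor (M : VonNeumannAlgebra H) : Prop :=
  M.IsII1Factor ∧
    ∃ (A : ℕ → StarSubalgebra ℂ (H →L[ℂ] H)) (k : ℕ → ℕ), Monotone A ∧
      (∀ n, Nonempty (A n ≃⋆ₐ[ℂ] Matrix (Fin (k n)) (Fin (k n)) ℂ)) ∧
      generatedBy (⋃ n, (A n : Set (H →L[ℂ] H))) = M

end Basic

end VonNeumannAlgebra

/-! ### The standard bimodule `L²` of a tracial state -/

namespace PositiveLinearMap

variable {A : Type u} [CStarAlgebra A] [PartialOrder A] [StarOrderedRing A]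

/-- Right multiplication by `a` on the pre-Hilbert space of a tracial positive functional. -/
noncomputable def rightMulPreGNS (f : A →ₚ[ℂ] ℂ) (hf : ∀ a b : A, f (a * b) = f (b * a)) (a : A) :
    f.PreGNS →L[ℂ] f.PreGNS :=
  (f.toPreGNS.toLinearMap ∘ₗ LinearMap.mulRight ℂ a ∘ₗ f.ofPreGNS.toLinearMap).mkContinuous ‖a‖
    fun x => by
      have key : ∀ y : A, ‖f.toPreGNS (star y)‖ = ‖f.toPreGNS y‖ := fun y => by
        rw [f.preGNS_norm_def, f.preGNS_norm_def]
        simp [hf y (star y)]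
      have h1 : ‖f.toPreGNS (star a * star (f.ofPreGNS x))‖
          ≤ ‖star a‖ * ‖f.toPreGNS (star (f.ofPreGNS x))‖ := by
        have := (f.leftMulMapPreGNS (star a)).le_of_opNorm_le
          (LinearMap.mkContinuous_norm_le _ (norm_nonneg _) _)
          (f.toPreGNS (star (f.ofPreGNS x)))
        simpa using this
      rw [← star_mul, key, key, norm_star] at h1
      simpa using h1

end PositiveLinearMap

namespace VonNeumannAlgebra.TracialState

variable {H : Type u} [NormedAddCommGroup H] [InnerProductSpace ℂ H] [CompleteSpace H]
  {M : VonNeumannAlgebra H} (τ : M.TracialState)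

/-- The Hilbert space `L²(M, τ)`: the completion of `M` for `⟪a, b⟫ = τ (a* b)`. -/
abbrev L2 : Type u := τ.toPositive.GNS

/-- The canonical map `M → L²(M, τ)`. -/
noncomputable def toL2 (a : M) : τ.L2 := (τ.toPositive.toPreGNS a : τ.toPositive.PreGNS)

/-- The left action of `M` on `L²(M, τ)`, extending `x ↦ a x`. -/
noncomputable def leftMul (a : M) : τ.L2 →L[ℂ] τ.L2 := τ.toPositive.gnsStarAlgHom a

/-- The right action of `M` on `L²(M, τ)`, extending `x ↦ x a`. -/
noncomputable def rightMul (a : M) : τ.L2 →L[ℂ] τ.L2 :=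
  (τ.toPositive.rightMulPreGNS τ.tracial a).completion

theorem leftMul_toL2 (a x : M) : τ.leftMul a (τ.toL2 x) = τ.toL2 (a * x) := by
  simp [leftMul, toL2]

theorem rightMul_toL2 (a x : M) : τ.rightMul a (τ.toL2 x) = τ.toL2 (x * a) := by
  simp [rightMul, toL2, PositiveLinearMap.rightMulPreGNS]

theorem inner_toL2 (x y : M) : inner ℂ (τ.toL2 x) (τ.toL2 y) = τ.toPositive (star x * y) := by
  simp [toL2, PositiveLinearMap.preGNS_inner_def]

/-- `(x n)` is a central sequence of `M`: it is norm bounded and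
`‖x n * m - m * x n‖₂ → 0` for every `m` in `M`, where `‖a‖₂ = τ (a* a) ^ (1 / 2)`. -/
def IsCentralSequence (x : ℕ → M) : Prop :=
  (∃ C : ℝ, ∀ n, ‖x n‖ ≤ C) ∧
    ∀ m : M, Tendsto (fun n => ‖τ.toL2 (x n * m - m * x n)‖) atTop (𝓝 0)

end VonNeumannAlgebra.TracialState

/-! ### Tensor products -/

/-- The Hilbert space tensor product. -/
abbrev HilbertTensor (H : Type u) (K : Type v) [NormedAddCommGroup H] [InnerProductSpace ℂ H]
    [NormedAddCommGroup K] [InnerProductSpace ℂ K] : Type (max u v) :=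
  UniformSpace.Completion (H ⊗[ℂ] K)

section Tensor

variable {H : Type u} [NormedAddCommGroup H] [InnerProductSpace ℂ H]
  {K : Type v} [NormedAddCommGroup K] [InnerProductSpace ℂ K]

/-- The operator `a ⊗ b` on the Hilbert space tensor product. -/
noncomputable def tensorOp (a : H →L[ℂ] H) (b : K →L[ℂ] K) :
    HilbertTensor H K →L[ℂ] HilbertTensor H K :=
  (TensorProduct.mapL a b).completion

theorem tensorOp_tmul (a : H →L[ℂ] H) (b : K →L[ℂ] K) (x : H) (y : K) :
    tensorOp a b ((x ⊗ₜ[ℂ] y : H ⊗[ℂ] K) : HilbertTensor H K) =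
      ((a x ⊗ₜ[ℂ] b y : H ⊗[ℂ] K) : HilbertTensor H K) := by
  simp [tensorOp]

variable [CompleteSpace H] [CompleteSpace K]

/-- The von Neumann algebra tensor product: generated by the operators `a ⊗ b` on the Hilbert space
tensor product. -/
noncomputable def VonNeumannAlgebra.tensor (M : VonNeumannAlgebra H) (N : VonNeumannAlgebra K) :
    VonNeumannAlgebra (HilbertTensor H K) :=
  VonNeumannAlgebra.generatedBy {T | ∃ a ∈ M, ∃ b ∈ N, T = tensorOp a b}

/-- The elementary tensor `a ⊗ b` as an element of the von Neumann algebra tensor product. -/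
noncomputable def VonNeumannAlgebra.tmul {M : VonNeumannAlgebra H} {N : VonNeumannAlgebra K}
    (a : M) (b : N) : M.tensor N :=
  ⟨tensorOp (a : H →L[ℂ] H) (b : K →L[ℂ] K),
    VonNeumannAlgebra.subset_generatedBy _ ⟨a, a.2, b, b.2, rfl⟩⟩

end Tensor



/-! ### The conjugate Hilbert space -/

/-- The complex conjugate of the Hilbert space `X`: same vectors, scalars acting through complex
conjugation. -/
def ConjSpace (X : Type u) : Type u := X
namespace ConjSpace

variable {X : Type u} [NormedAddCommGroup X] [InnerProductSpace ℂ X]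
instance : NormedAddCommGroup (ConjSpace X) := inferInstanceAs (NormedAddCommGroup X)
instance [CompleteSpace X] : CompleteSpace (ConjSpace X) := inferInstanceAs (CompleteSpace X)
noncomputable instance : Module ℂ (ConjSpace X) := Module.compHom X (starRingEnd ℂ)
/-- The identity map. -/
def of : X ≃+ ConjSpace X := AddEquiv.refl X
theorem of_smul (c : ℂ) (x : X) : of (c • x) = starRingEnd ℂ c • of x := by
  change c • x = starRingEnd ℂ (starRingEnd ℂ c) • x
  simp
theorem smul_of (c : ℂ) (x : X) : c • of x = of (starRingEnd ℂ c • x) := rfl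
noncomputable instance : InnerProductSpace ℂ (ConjSpace X) where
  norm_smul_le c x := by
    change ‖starRingEnd ℂ c • of.symm x‖ ≤ ‖c‖ * ‖of.symm x‖
    rw [norm_smul, RCLike.norm_conj]
  inner x y := inner ℂ (of.symm y) (of.symm x)
  norm_sq_eq_re_inner x := norm_sq_eq_re_inner (𝕜 := ℂ) (of.symm x)
  conj_inner_symm x y := inner_conj_symm (𝕜 := ℂ) (of.symm y) (of.symm x)
  add_left x y z := inner_add_right (𝕜 := ℂ) (of.symm z) (of.symm x) (of.symm y)
  smul_left x y c := inner_smul_right (𝕜 := ℂ) (of.symm y) (of.symm x) (starRingEnd ℂ c)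
theorem inner_of (x y : X) : inner ℂ (of x) (of y) = inner ℂ y x := rfl

/-- A bounded operator on `X`, regarded as an operator on the conjugate Hilbert space. -/
noncomputable def mapOp (T : X →L[ℂ] X) : ConjSpace X →L[ℂ] ConjSpace X where
  toFun x := of (T (of.symm x))
  map_add' x y := by simp
  map_smul' c x := by
    change T (starRingEnd ℂ c • of.symm x) = starRingEnd ℂ c • T (of.symm x)
    simp
  cont := T.continuous
theorem mapOp_of (T : X →L[ℂ] X) (x : X) : mapOp T (of x) = of (T x) := rfl

theorem mapOp_one : mapOp (1 : X →L[ℂ] X) = 1 := rfl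

theorem mapOp_zero : mapOp (0 : X →L[ℂ] X) = 0 := rfl

theorem mapOp_mul (S T : X →L[ℂ] X) : mapOp (S * T) = mapOp S * mapOp T := rfl

theorem mapOp_add (S T : X →L[ℂ] X) : mapOp (S + T) = mapOp S + mapOp T := rfl

theorem mapOp_smul (c : ℂ) (T : X →L[ℂ] X) :
    mapOp (c • T) = starRingEnd ℂ c • mapOp T := by
  ext x
  exact of_smul c (T (of.symm x))

theorem mapOp_star [CompleteSpace X] (T : X →L[ℂ] X) : mapOp (star T) = star (mapOp T) := by
  refine (ContinuousLinearMap.eq_adjoint_iff _ _).mpr fun x y => ?_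
  change inner ℂ (of.symm y) (star T (of.symm x)) = inner ℂ (T (of.symm y)) (of.symm x)
  rw [ContinuousLinearMap.star_eq_adjoint, ContinuousLinearMap.adjoint_inner_right]

end ConjSpace

/-! ### Hilbert bimodules -/

/-- An `M`-`N` Hilbert bimodule structure on the Hilbert space `X`: commuting unital normal
star representations of `M` and of the opposite algebra of `N`. Thus `left a x` is `a x`
and `right (op b) x` is `x b`. -/
structure HilbertBimodule {H : Type u} [NormedAddCommGroup H] [InnerProductSpace ℂ H]
    [CompleteSpace H] {K : Type v} [NormedAddCommGroup K] [InnerProductSpace ℂ K] [CompleteSpace K]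
    (M : VonNeumannAlgebra H) (N : VonNeumannAlgebra K)
    (X : Type w) [NormedAddCommGroup X] [InnerProductSpace ℂ X] [CompleteSpace X] where
  left : M →⋆ₐ[ℂ] (X →L[ℂ] X)
  right : Nᵐᵒᵖ →⋆ₐ[ℂ] (X →L[ℂ] X)
  commute : ∀ (a : M) (b : N) (x : X), left a (right (op b) x) = right (op b) (left a x)
  left_normal : ∀ x y : X, M.IsNormalFunctional fun a => inner ℂ x (left a y)
  right_normal : ∀ x y : X, N.IsNormalFunctional fun b => inner ℂ x (right (op b) y)

namespace HilbertBimodule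

section General

variable {H : Type u} [NormedAddCommGroup H] [InnerProductSpace ℂ H] [CompleteSpace H]
  {K : Type v} [NormedAddCommGroup K] [InnerProductSpace ℂ K] [CompleteSpace K]
  {M : VonNeumannAlgebra H} {N : VonNeumannAlgebra K}
  {X : Type w} [NormedAddCommGroup X] [InnerProductSpace ℂ X] [CompleteSpace X]
  {Y : Type w'} [NormedAddCommGroup Y] [InnerProductSpace ℂ Y] [CompleteSpace Y]

/-- Unitary isomorphism of `M`-`N` Hilbert bimodules. -/
def IsIsomorphic (α : HilbertBimodule M N X) (β : HilbertBimodule M N Y) : Prop :=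
  ∃ U : X ≃ₗᵢ[ℂ] Y, (∀ (a : M) (x : X), U (α.left a x) = β.left a (U x)) ∧
    ∀ (b : N) (x : X), U (α.right (op b) x) = β.right (op b) (U x)

/-- The conjugate bimodule, with actions `b x̄ a = conj (a* x b*)`. -/
noncomputable def conj (α : HilbertBimodule M N X) : HilbertBimodule N M (ConjSpace X) where
  left :=
    { toFun := fun b => ConjSpace.mapOp (α.right (op (star b)))
      map_one' := by simp [ConjSpace.mapOp_one]
      map_mul' := fun a b => by
        rw [star_mul, op_mul, map_mul, ConjSpace.mapOp_mul]
      map_zero' := by simp [ConjSpace.mapOp_zero]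
      map_add' := fun a b => by
        rw [star_add, op_add, map_add, ConjSpace.mapOp_add]
      commutes' := fun c => by
        rw [Algebra.algebraMap_eq_smul_one, star_smul, star_one, op_smul, op_one, map_smul,
          map_one, ConjSpace.mapOp_smul, ConjSpace.mapOp_one, Algebra.algebraMap_eq_smul_one]
        simp
      map_star' := fun a => by
        rw [← ConjSpace.mapOp_star, ← map_star, op_star] }
  right :=
    { toFun := fun a => ConjSpace.mapOp (α.left (star a.unop))
      map_one' := by simp [ConjSpace.mapOp_one]
      map_mul' := fun a b => by
        rw [unop_mul, star_mul, map_mul, ConjSpace.mapOp_mul]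
      map_zero' := by simp [ConjSpace.mapOp_zero]
      map_add' := fun a b => by
        rw [unop_add, star_add, map_add, ConjSpace.mapOp_add]
      commutes' := fun c => by
        rw [Algebra.algebraMap_eq_smul_one, unop_smul, unop_one, star_smul, star_one, map_smul,
          map_one, ConjSpace.mapOp_smul, ConjSpace.mapOp_one, Algebra.algebraMap_eq_smul_one]
        simp
      map_star' := fun a => by
        rw [← ConjSpace.mapOp_star, ← map_star, unop_star] }
  commute := fun b a x => congrArg ConjSpace.of
    (α.commute (star a) (star b) (ConjSpace.of.symm x)).symm
  left_normal := fun x y => by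
    convert! α.right_normal (ConjSpace.of.symm y) (ConjSpace.of.symm x) using 2 with b
    change inner ℂ (α.right (op (star b)) (ConjSpace.of.symm y)) (ConjSpace.of.symm x) = _
    rw [op_star, map_star, ContinuousLinearMap.star_eq_adjoint,
      ContinuousLinearMap.adjoint_inner_left]
  right_normal := fun x y => by
    convert! α.left_normal (ConjSpace.of.symm y) (ConjSpace.of.symm x) using 2 with a
    change inner ℂ (α.left (star a) (ConjSpace.of.symm y)) (ConjSpace.of.symm x) = _
    rw [map_star, ContinuousLinearMap.star_eq_adjoint, ContinuousLinearMap.adjoint_inner_left]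

end General

section Tensor

variable {H : Type u} [NormedAddCommGroup H] [InnerProductSpace ℂ H] [CompleteSpace H]
  {K : Type v} [NormedAddCommGroup K] [InnerProductSpace ℂ K] [CompleteSpace K]
  {R : VonNeumannAlgebra H} {S : VonNeumannAlgebra K}
  {X : Type w} [NormedAddCommGroup X] [InnerProductSpace ℂ X] [CompleteSpace X]

/-- `β` is the `(R ⊗ S)`-`(R ⊗ S)` bimodule `L²R ⊗ X`, where `κ` is the `S`-`S` bimodule structure
of `X`: elementary tensors act as `(r ⊗ s) (x ⊗ y) = r x ⊗ s y` and
`(x ⊗ y) (r ⊗ s) = x r ⊗ y s`. (By normality, this determines both actions.) -/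
def IsL2Tensor (τ : R.TracialState) (κ : HilbertBimodule S S X)
    (β : HilbertBimodule (R.tensor S) (R.tensor S) (HilbertTensor τ.L2 X)) : Prop :=
  ∀ (r : R) (s : S),
    β.left (VonNeumannAlgebra.tmul r s) = tensorOp (τ.leftMul r) (κ.left s) ∧
    β.right (op (VonNeumannAlgebra.tmul r s)) = tensorOp (τ.rightMul r) (κ.right (op s))

end Tensor

section Chi

variable {H : Type u} [NormedAddCommGroup H] [InnerProductSpace ℂ H] [CompleteSpace H]
  {M : VonNeumannAlgebra H} (τ : M.TracialState)
  {X : Type w} [NormedAddCommGroup X] [InnerProductSpace ℂ X] [CompleteSpace X]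

/-- `α` is isomorphic, as an `M`-`M` bimodule, to the direct sum of `n` copies of `L²M`. -/
def IsMultipleOfL2 (α : HilbertBimodule M M X) (n : ℕ) : Prop :=
  ∃ U : X ≃ₗᵢ[ℂ] PiLp 2 (fun _ : Fin n => τ.L2),
    (∀ (a : M) (x : X) (i : Fin n), U (α.left a x) i = τ.leftMul a (U x i)) ∧
    ∀ (a : M) (x : X) (i : Fin n), U (α.right (op a) x) i = τ.rightMul a (U x i)

/-- The right `M`-module underlying `α` is finitely generated projective: it embeds isometrically
(hence, the range being closed, as a direct summand) in a finite multiple of `L²M`. -/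
def IsRightFinite (α : HilbertBimodule M M X) : Prop :=
  ∃ (n : ℕ) (V : X →ₗᵢ[ℂ] PiLp 2 (fun _ : Fin n => τ.L2)),
    ∀ (a : M) (x : X) (i : Fin n), V (α.right (op a) x) i = τ.rightMul a (V x i)

/-- `α` is centrally trivial: `‖a_n x - x a_n‖ → 0` for all central sequences `(a_n)` of `M` and all
vectors `x`. -/
def IsCentrallyTrivial (α : HilbertBimodule M M X) : Prop :=
  ∀ a : ℕ → M, τ.IsCentralSequence a → ∀ x : X,
    Tendsto (fun n => ‖α.left (a n) x - α.right (op (a n)) x‖) atTop (𝓝 0)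

/-- `α` is approximately inner: it has an approximately inner basis. A right-bounded vector `b` is
represented by the bounded right `M`-linear operator `L : L²M → X` with `L (a) = b a`,
so that `b = L 1` and `b ⟨b | x⟩_M = L (L* x)`. -/
def IsApproximatelyInner (α : HilbertBimodule M M X) : Prop :=
  ∃ (m : ℕ) (L : ℕ → Fin m → (τ.L2 →L[ℂ] X)),
    (∀ n i (a : M) (v : τ.L2), L n i (τ.rightMul a v) = α.right (op a) (L n i v)) ∧
    (∃ C : ℝ, ∀ n i, ‖L n i‖ ≤ C) ∧
    (∀ x : X, Tendsto (fun n => ∑ i, L n i (ContinuousLinearMap.adjoint (L n i) x)) atTop (𝓝 x)) ∧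
    ∀ (a : M) (i : Fin m), Tendsto
      (fun n => ‖α.left a (L n i (τ.toL2 1)) - α.right (op a) (L n i (τ.toL2 1))‖) atTop (𝓝 0)

/-- `α` is an object of `χ̃(M)`: a bifinite bimodule such that both it and its conjugate are
approximately inner and centrally trivial. -/
def MemChiTilde (α : HilbertBimodule M M X) : Prop :=
  (α.IsRightFinite τ ∧ α.conj.IsRightFinite τ) ∧
  (α.IsApproximatelyInner τ ∧ α.conj.IsApproximatelyInner τ) ∧
  (α.IsCentrallyTrivial τ ∧ α.conj.IsCentrallyTrivial τ)

end Chi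

end HilbertBimodule

/-! `R` contains an increasing sequence of matrix algebras `B n` whose union is dense in the 2-norm.
A norm bounded sequence with `x n` in the relative commutant of `B n` is therefore central, and
central triviality, a condition on sequences, becomes a uniform one: for every vector ξ and ε > 0
there is an n with ‖xξ - ξx‖ ≤ ε on the whole unit ball of the relative commutant of `B n`
(`IsCentrallyTrivial.exists_uniform`). The vector of least norm in the closed convex hull of the
uξu*, with u a unitary of that relative commutant, is then within ε of ξ and commutes with the
relative commutant (`exists_commuting_near`). Since `R` consists of matrices over the relative
commutant, such a vector is a sum of terms e_pq ζ_pq with each ζ_pq commuting with all of `R`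
(`mem_span_of_commute`). So if K denotes the closed space of `R`-central vectors, R·K spans a dense
subspace.

For k, k' in K, the functional a ↦ ⟪k, a k'⟫ is a normal trace, hence equals τ(a)⟪k, k'⟫ by
uniqueness of the trace (`inner_left_left_central`). Thus a k ↦ a ⊗ k extends to a unitary onto L²R
⊗ K. For a bimodule over R ⊗ S, both actions of 1 ⊗ S commute with those of R and so preserve K,
which becomes the required S-S bimodule (`exists_isL2Tensor`).

For part (2), the same analysis gives L²R ⊗ K, and a right linear isometric embedding into n copies
of L²R forces dim K ≤ n (`card_le_of_orthonormal`). Conversely, the properties of a finite multiple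
of L²R are verified directly, and they pass to the conjugate because a ↦ a* identifies L²R with its
conjugate.

The analytic input is the double commutant theorem for amplifications: it yields the 2-norm density
of the union of the `B n` and shows that a normal functional is determined by its values there. -/

/-! ### Amplifications and the double commutant theorem -/

section Amplification

variable {H : Type u} [NormedAddCommGroup H] [InnerProductSpace ℂ H]

/-- The amplification of `a`, acting diagonally on the Hilbert sum of copies of `H`. -/
noncomputable def amplification (ι : Type w) (a : H →L[ℂ] H) :
    lp (fun _ : ι => H) 2 →L[ℂ] lp (fun _ : ι => H) 2 :=
  lp.mapCLM 2 (fun _ => a) (norm_nonneg a) (fun _ => le_rfl)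

variable {ι : Type w}

@[simp]
theorem amplification_apply (a : H →L[ℂ] H) (f : lp (fun _ : ι => H) 2) (i : ι) :
    amplification ι a f i = a (f i) := by
  simp [amplification]

theorem amplification_mul (a b : H →L[ℂ] H) (f : lp (fun _ : ι => H) 2) :
    amplification ι (a * b) f = amplification ι a (amplification ι b f) := by
  ext i; simp

theorem amplification_sub (a b : H →L[ℂ] H) (f : lp (fun _ : ι => H) 2) :
    amplification ι (a - b) f = amplification ι a f - amplification ι b f := by
  ext i; simp

theorem amplification_single [DecidableEq ι] (a : H →L[ℂ] H) (j : ι) (y : H) :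
    amplification ι a (lp.single 2 j y) = lp.single 2 j (a y) := by
  ext i
  by_cases h : i = j
  · subst h; simp
  · simp [h]

/-- The orbit map `a ↦ (a ⊗ 1) ζ`. -/
noncomputable def amplificationOrbit (ζ : lp (fun _ : ι => H) 2) :
    (H →L[ℂ] H) →ₗ[ℂ] lp (fun _ : ι => H) 2 where
  toFun a := amplification ι a ζ
  map_add' a b := by ext i; simp
  map_smul' c a := by ext i; simp

variable [CompleteSpace H]

theorem inner_amplification_left (a : H →L[ℂ] H) (f g : lp (fun _ : ι => H) 2) :
    inner ℂ (amplification ι a f) g = inner ℂ f (amplification ι (star a) g) := by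
  rw [lp.inner_eq_tsum, lp.inner_eq_tsum]
  simp [ContinuousLinearMap.star_eq_adjoint, ContinuousLinearMap.adjoint_inner_right]

/-- The double commutant theorem, for the strong topology of an amplification. -/
theorem exists_norm_amplification_sub_lt (A : StarSubalgebra ℂ (H →L[ℂ] H))
    {x : H →L[ℂ] H} (hx : x ∈ Set.centralizer (Set.centralizer (A : Set (H →L[ℂ] H))))
    (ζ : lp (fun _ : ι => H) 2) {ε : ℝ} (hε : 0 < ε) :
    ∃ a ∈ A, ‖amplification ι (x - a) ζ‖ < ε := by
  classical
  set S : Submodule ℂ (lp (fun _ : ι => H) 2) :=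
    (Subalgebra.toSubmodule A.toSubalgebra).map (amplificationOrbit ζ) with hS
  set W := S.topologicalClosure with hW
  have : CompleteSpace W := S.isClosed_topologicalClosure.completeSpace_coe
  have hinv : ∀ b ∈ A, ∀ w ∈ W, amplification ι b w ∈ W := by
    intro b hb w hw
    refine map_mem_closure (amplification ι b).continuous hw ?_
    rintro _ ⟨a, ha, rfl⟩
    exact ⟨b * a, A.mul_mem hb ha, amplification_mul b a ζ⟩
  have hcomm : ∀ b ∈ A, ∀ v, W.starProjection (amplification ι b v) =
      amplification ι b (W.starProjection v) := by
    intro b hb v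
    refine Submodule.eq_starProjection_of_mem_of_inner_eq_zero
      (hinv b hb _ (W.starProjection_apply_mem v)) fun w hw => ?_
    rw [← map_sub, inner_amplification_left]
    exact Submodule.starProjection_inner_eq_zero v _ (hinv _ (star_mem hb) w hw)
  -- The projection onto W commutes with the diagonal action of A, so each of its matrix entries
  -- lies in the commutant of A.
  have hentry : ∀ i j, lp.evalCLM ℂ (fun _ : ι => H) 2 i ∘L W.starProjection ∘L
      lp.singleContinuousLinearMap ℂ (fun _ : ι => H) 2 j ∈
        Set.centralizer (A : Set (H →L[ℂ] H)) := by
    intro i j b hb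
    ext y
    have := congrArg (fun f => f i) (hcomm b hb (lp.single 2 j y))
    simp only [amplification_single, amplification_apply] at this
    exact this.symm
  -- As x commutes with all these entries, its amplification commutes with the projection; this is
  -- checked on one summand of v at a time.
  have hcommx : W.starProjection ∘L amplification ι x = amplification ι x ∘L W.starProjection := by
    ext v : 1
    have hs := lp.hasSum_single (p := 2) (by simp) v
    refine (hs.mapL (W.starProjection ∘L amplification ι x)).unique ?_
    convert! hs.mapL (amplification ι x ∘L W.starProjection) using 2 with j
    ext i
    have := congrArg (fun T => T (v j)) (hx _ (hentry i j))
    simp only [ContinuousLinearMap.comp_apply, amplification_single, amplification_apply]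
    exact this
  have hζ : ζ ∈ W := S.le_topologicalClosure ⟨1, one_mem A, by ext i; simp [amplificationOrbit]⟩
  have hxζ : amplification ι x ζ ∈ W := by
    have := congrArg (fun T => T ζ) hcommx
    simp only [ContinuousLinearMap.comp_apply, W.starProjection_eq_self_iff.mpr hζ] at this
    rw [← this]
    exact W.starProjection_apply_mem _
  obtain ⟨_, ⟨a, ha, rfl⟩, h⟩ := Metric.mem_closure_iff.mp hxζ ε hε
  refine ⟨a, ha, ?_⟩
  rw [amplification_sub, ← dist_eq_norm]
  exact h

/-- Simultaneous strong approximation on two vectors of an amplification. -/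
theorem exists_norm_amplification_sub_lt₂ (A : StarSubalgebra ℂ (H →L[ℂ] H))
    {x : H →L[ℂ] H} (hx : x ∈ Set.centralizer (Set.centralizer (A : Set (H →L[ℂ] H))))
    (ξ η : lp (fun _ : ι => H) 2) {ε : ℝ} (hε : 0 < ε) :
    ∃ a ∈ A, ‖amplification ι (x - a) ξ‖ < ε ∧ ‖amplification ι (x - a) η‖ < ε := by
  have hsq : ∀ {κ : Type w} (f : lp (fun _ : κ => H) 2), HasSum (fun i => ‖f i‖ ^ 2) (‖f‖ ^ 2) := by
    intro κ f
    simpa using lp.hasSum_norm (p := 2) (by simp) f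
  -- Concatenating the two vectors into one vector over ι ⊕ ι makes a single a serve both.
  have hmem : Memℓp (E := fun _ : ι ⊕ ι => H) (Sum.elim ξ η) 2 := by
    refine memℓp_gen ?_
    refine ((HasSum.sum (f := fun i : ι ⊕ ι => ‖(Sum.elim ξ η : ι ⊕ ι → H) i‖ ^ 2)
      (hsq ξ) (hsq η)).summable).congr fun i => by simp
  obtain ⟨a, ha, h⟩ := exists_norm_amplification_sub_lt A hx
    (⟨Sum.elim ξ η, hmem⟩ : lp (fun _ : ι ⊕ ι => H) 2) hε
  have hadd := (hsq (amplification (ι ⊕ ι) (x - a) ⟨Sum.elim ξ η, hmem⟩)).unique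
    (HasSum.sum (f := fun i => ‖(amplification (ι ⊕ ι) (x - a)
      (⟨Sum.elim ξ η, hmem⟩ : lp (fun _ : ι ⊕ ι => H) 2)) i‖ ^ 2)
      (a := ‖amplification ι (x - a) ξ‖ ^ 2) (b := ‖amplification ι (x - a) η‖ ^ 2)
      (by simpa [Function.comp_def] using hsq (amplification ι (x - a) ξ))
      (by simpa [Function.comp_def] using hsq (amplification ι (x - a) η)))
  refine ⟨a, ha, lt_of_le_of_lt (abs_le_of_sq_le_sq' ?_ (norm_nonneg _)).2 h,
    lt_of_le_of_lt (abs_le_of_sq_le_sq' ?_ (norm_nonneg _)).2 h⟩ <;> rw [hadd]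
  · exact le_add_of_nonneg_right (sq_nonneg _)
  · exact le_add_of_nonneg_left (sq_nonneg _)

end Amplification

/-- Linear maps with dense ranges and the same norms induce a unitary. -/
theorem exists_linearIsometryEquiv_of_norm_eq {V X Y : Type*} [AddCommGroup V] [Module ℂ V]
    [NormedAddCommGroup X] [NormedSpace ℂ X] [CompleteSpace X]
    [NormedAddCommGroup Y] [NormedSpace ℂ Y] [CompleteSpace Y]
    (f : V →ₗ[ℂ] X) (g : V →ₗ[ℂ] Y) (hf : DenseRange f) (hg : DenseRange g)
    (h : ∀ v, ‖f v‖ = ‖g v‖) : ∃ U : X ≃ₗᵢ[ℂ] Y, ∀ v, U (f v) = g v :=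
  ⟨(LinearEquiv.refl ℂ V).extendOfIsometry f g hf hg fun v => (h v).symm, fun v =>
    LinearEquiv.extendOfIsometry_eq _ f g hf hg (fun v => (h v).symm) v⟩

/-! ### Normal functionals and density in the 2-norm. -/

namespace VonNeumannAlgebra

variable {H : Type u} [NormedAddCommGroup H] [InnerProductSpace ℂ H] [CompleteSpace H]
  {M : VonNeumannAlgebra H}

/-- Families over arbitrary index types define normal functionals, since only countably many of
the vectors are nonzero. -/
theorem isNormalFunctional_of_hasSum {ι : Type w} {φ : M → ℂ} (ξ η : ι → H)
    (hξ : Summable fun i => ‖ξ i‖ ^ 2) (hη : Summable fun i => ‖η i‖ ^ 2)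
    (h : ∀ a : M, HasSum (fun i => inner ℂ (ξ i) ((a : H →L[ℂ] H) (η i))) (φ a)) :
    M.IsNormalFunctional φ := by
  have hs : (Function.support fun i => ‖ξ i‖ ^ 2).Countable := hξ.countable_support
  set s := Function.support fun i => ‖ξ i‖ ^ 2 with hsdef
  have := hs.to_subtype
  obtain ⟨e, he⟩ := exists_injective_nat s
  -- The indices in the support of ξ are sent injectively into ℕ and the families are extended by
  -- zero. Indices outside the support contribute nothing, whatever η is there.
  have hext : ∀ (ζ : ι → H) (n : ℕ), n ∉ Set.range e →
      Function.extend e (fun i : s => ζ i) 0 n = 0 := fun ζ n hn =>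
    Function.extend_apply' _ _ _ fun ⟨i, hi⟩ => hn ⟨i, hi⟩
  have hsum : ∀ ζ : ι → H, Summable (fun i => ‖ζ i‖ ^ 2) →
      Summable fun n => ‖Function.extend e (fun i : s => ζ i) 0 n‖ ^ 2 := by
    intro ζ hζ
    refine (he.summable_iff fun n hn => by simp [hext ζ n hn]).mp ?_
    simpa only [Function.comp_def, he.extend_apply] using! hζ.subtype s
  refine ⟨_, _, hsum ξ hξ, hsum η hη, fun a => ?_⟩
  refine (he.hasSum_iff fun n hn => by simp [hext ξ n hn]).mp ?_
  simp only [Function.comp_def, he.extend_apply]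
  refine (hasSum_subtype_iff_of_support_subset (f := fun i => inner ℂ (ξ i)
    ((a : H →L[ℂ] H) (η i))) fun i hi => ?_).mpr (h a)
  by_contra h0
  have : ξ i = 0 := by simpa [hsdef] using h0
  simp [this] at hi

/-- A normal functional is a vector functional of the countable amplification, the form in which the
double commutant theorem can be applied to it. -/
theorem IsNormalFunctional.exists_lp {φ : M → ℂ} (hφ : M.IsNormalFunctional φ) :
    ∃ ξ η : lp (fun _ : ℕ => H) 2, ∀ a : M, φ a = inner ℂ ξ (amplification ℕ (a : H →L[ℂ] H) η) := by
  obtain ⟨ξ, η, hξ, hη, h⟩ := hφ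
  refine ⟨⟨ξ, ?_⟩, ⟨η, ?_⟩, fun a => (h a).unique ?_⟩
  · exact memℓp_gen (by simpa using hξ)
  · exact memℓp_gen (by simpa using hη)
  · simpa using lp.hasSum_inner (𝕜 := ℂ) (⟨ξ, memℓp_gen (by simpa using hξ)⟩ : lp (fun _ : ℕ => H) 2)
      (amplification ℕ (a : H →L[ℂ] H) ⟨η, memℓp_gen (by simpa using hη)⟩)

variable {A : StarSubalgebra ℂ (H →L[ℂ] H)}

/-- A normal functional on `A''` is determined by its restriction to `A`. -/
theorem IsNormalFunctional.eq_of_eqOn {φ ψ : M → ℂ} (hφ : M.IsNormalFunctional φ)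
    (hψ : M.IsNormalFunctional ψ)
    (hA : Set.centralizer (Set.centralizer (A : Set (H →L[ℂ] H))) = M)
    (h : ∀ a : M, (a : H →L[ℂ] H) ∈ A → φ a = ψ a) : φ = ψ := by
  obtain ⟨ξ, η, hφ⟩ := hφ.exists_lp
  obtain ⟨ξ', η', hψ⟩ := hψ.exists_lp
  funext x
  refine eq_of_forall_dist_le fun ε hε => ?_
  -- The summand 1 keeps the denominator positive when ξ and ξ' both vanish.
  have hpos : 0 < ‖ξ‖ + ‖ξ'‖ + 1 := by positivity
  obtain ⟨a, ha, h1, h2⟩ := exists_norm_amplification_sub_lt₂ A (x := x) (by rw [hA]; exact x.2) η η'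
    (div_pos hε hpos)
  have haM : a ∈ M := by
    rw [← SetLike.mem_coe, ← hA]
    exact Set.subset_centralizer_centralizer ha
  have heq := h ⟨a, haM⟩ ha
  have : φ x - ψ x = inner ℂ ξ (amplification ℕ ((x : H →L[ℂ] H) - a) η) -
      inner ℂ ξ' (amplification ℕ ((x : H →L[ℂ] H) - a) η') := by
    rw [hφ, hψ] at heq
    rw [hφ, hψ, amplification_sub, amplification_sub, inner_sub_right, inner_sub_right]
    linear_combination heq
  rw [dist_eq_norm, this]
  calc _ ≤ ‖ξ‖ * (ε / (‖ξ‖ + ‖ξ'‖ + 1)) + ‖ξ'‖ * (ε / (‖ξ‖ + ‖ξ'‖ + 1)) := by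
        refine (norm_sub_le _ _).trans (add_le_add ?_ ?_)
        · exact (norm_inner_le_norm _ _).trans (by gcongr)
        · exact (norm_inner_le_norm _ _).trans (by gcongr)
    _ = (‖ξ‖ + ‖ξ'‖) / (‖ξ‖ + ‖ξ'‖ + 1) * ε := by ring
    _ ≤ 1 * ε := by
        gcongr
        rw [div_le_one hpos]
        linarith
    _ = ε := one_mul ε

namespace TracialState

variable (τ : M.TracialState)

/-- The canonical map `M → L²(M, τ)` as a linear map. -/
noncomputable def toL2ₗ : M →ₗ[ℂ] τ.L2 where
  toFun := τ.toL2
  map_add' a b := by simp [toL2, UniformSpace.Completion.coe_add]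
  map_smul' c a := by simp [toL2]

theorem toL2_sub (a b : M) : τ.toL2 (a - b) = τ.toL2 a - τ.toL2 b := τ.toL2ₗ.map_sub a b

theorem denseRange_toL2 : DenseRange τ.toL2 :=
  UniformSpace.Completion.denseRange_coe.comp τ.toPositive.toPreGNS.surjective.denseRange
    (UniformSpace.Completion.continuous_coe _)

theorem norm_toL2_sq (a : M) : (‖τ.toL2 a‖ ^ 2 : ℂ) = τ.toPositive (star a * a) := by
  rw [← τ.inner_toL2, inner_self_eq_norm_sq_to_K]
  rfl

theorem norm_toL2_star (a : M) : ‖τ.toL2 (star a)‖ = ‖τ.toL2 a‖ := by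
  refine (sq_eq_sq₀ (norm_nonneg _) (norm_nonneg _)).mp (Complex.ofReal_injective ?_)
  push_cast
  rw [norm_toL2_sq, norm_toL2_sq, star_star, τ.tracial]

theorem norm_leftMul_apply_le (a : M) (v : τ.L2) : ‖τ.leftMul a v‖ ≤ ‖a‖ * ‖v‖ :=
  ((τ.leftMul a).le_opNorm v).trans
    (mul_le_mul_of_nonneg_right (NonUnitalStarAlgHom.norm_apply_le τ.toPositive.gnsStarAlgHom a)
      (norm_nonneg v))

theorem norm_toL2_mul_le (a b : M) : ‖τ.toL2 (a * b)‖ ≤ ‖a‖ * ‖τ.toL2 b‖ := by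
  rw [← leftMul_toL2]
  exact τ.norm_leftMul_apply_le a _

theorem norm_toL2_mul_le' (a b : M) : ‖τ.toL2 (a * b)‖ ≤ ‖b‖ * ‖τ.toL2 a‖ := by
  rw [← norm_toL2_star, star_mul, ← norm_toL2_star τ a, ← norm_star b]
  exact τ.norm_toL2_mul_le _ _

theorem norm_rightMul_apply_le (a : M) (v : τ.L2) : ‖τ.rightMul a v‖ ≤ ‖a‖ * ‖v‖ := by
  induction v using τ.denseRange_toL2.induction_on with
  | hp => exact isClosed_le (by fun_prop) (by fun_prop)
  | ih x =>
    rw [rightMul_toL2]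
    exact τ.norm_toL2_mul_le' x a

/-- A generating star subalgebra is dense in the `2`-norm. -/
theorem exists_norm_toL2_sub_lt
    (hA : Set.centralizer (Set.centralizer (A : Set (H →L[ℂ] H))) = M) (x : M) {ε : ℝ}
    (hε : 0 < ε) : ∃ a : M, (a : H →L[ℂ] H) ∈ A ∧ ‖τ.toL2 (x - a)‖ < ε := by
  obtain ⟨ξ, η, hτ⟩ := τ.normal.exists_lp
  obtain ⟨a, ha, h1, h2⟩ := exists_norm_amplification_sub_lt₂ A (x := x)
    (by rw [hA]; exact x.2) ξ η hε
  have haM : a ∈ M := by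
    rw [← SetLike.mem_coe, ← hA]
    exact Set.subset_centralizer_centralizer ha
  refine ⟨⟨a, haM⟩, ha, ?_⟩
  refine lt_of_pow_lt_pow_left₀ 2 hε.le ?_
  set y : M := x - ⟨a, haM⟩ with hy
  -- Normality of τ turns τ(y*y) into ⟪yξ, yη⟫, so strong approximation on the two vectors ξ and η
  -- controls the 2-norm.
  have hsq : (‖τ.toL2 y‖ ^ 2 : ℂ) =
      inner ℂ (amplification ℕ (y : H →L[ℂ] H) ξ) (amplification ℕ (y : H →L[ℂ] H) η) := by
    rw [norm_toL2_sq, hτ, inner_amplification_left]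
    exact congrArg _ (amplification_mul _ _ _)
  have : ‖τ.toL2 y‖ ^ 2 ≤
      ‖amplification ℕ (y : H →L[ℂ] H) ξ‖ * ‖amplification ℕ (y : H →L[ℂ] H) η‖ := by
    have h := norm_inner_le_norm (𝕜 := ℂ) (amplification ℕ (y : H →L[ℂ] H) ξ)
      (amplification ℕ (y : H →L[ℂ] H) η)
    rw [← hsq] at h
    simpa using h
  calc _ ≤ _ := this
    _ < ε * ε := mul_lt_mul'' h1 h2 (norm_nonneg _) (norm_nonneg _)
    _ = ε ^ 2 := (sq ε).symm

end TracialState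

end VonNeumannAlgebra

/-! ### Slices of the Hilbert space tensor product -/

/-- Only additivity is required, so that the conjugate-linear variable of an inner product is
covered as well. -/
theorem hilbertTensor_induction {E : Type u} [NormedAddCommGroup E] [InnerProductSpace ℂ E]
    {H : Type v} [NormedAddCommGroup H] [InnerProductSpace ℂ H] {Z : Type*} [TopologicalSpace Z]
    [AddMonoid Z] [T2Space Z] {f g : HilbertTensor E H → Z} (hf : Continuous f) (hg : Continuous g)
    (hf0 : f 0 = g 0) (hfa : ∀ x y, f (x + y) = f x + f y) (hga : ∀ x y, g (x + y) = g x + g y)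
    (h : ∀ x y, f ((x ⊗ₜ[ℂ] y : E ⊗[ℂ] H) : HilbertTensor E H) =
      g ((x ⊗ₜ[ℂ] y : E ⊗[ℂ] H) : HilbertTensor E H)) (ζ : HilbertTensor E H) : f ζ = g ζ := by
  induction ζ using UniformSpace.Completion.induction_on with
  | hp => exact isClosed_eq hf hg
  | ih t =>
    induction t with
    | zero => exact hf0
    | tmul x y => exact h x y
    | add s t hs ht => rw [UniformSpace.Completion.coe_add, hfa, hga, hs, ht]

section Slices

variable {E : Type u} [NormedAddCommGroup E] [InnerProductSpace ℂ E]
  {H : Type v} [NormedAddCommGroup H] [InnerProductSpace ℂ H]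

theorem exists_extension_preserving_inner {V : Type*} [NormedAddCommGroup V]
    [InnerProductSpace ℂ V] {Z : Type*} [NormedAddCommGroup Z] [InnerProductSpace ℂ Z]
    [CompleteSpace Z] (f : V →ₗ[ℂ] Z) (hf : ∀ v w, inner ℂ (f v) (f w) = inner ℂ v w) :
    ∃ W : UniformSpace.Completion V →L[ℂ] Z, (∀ v : V, W v = f v) ∧
      ∀ ξ η, inner ℂ (W ξ) (W η) = inner ℂ ξ η := by
  have hnorm : ∀ v, ‖f v‖ ≤ 1 * ‖(UniformSpace.Completion.toComplL : V →L[ℂ] _) v‖ := fun v => by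
    have : ‖f v‖ = ‖v‖ := by rw [norm_eq_sqrt_re_inner (𝕜 := ℂ), hf, ← norm_eq_sqrt_re_inner]
    simp [this]
  have hW : ∀ v : V, f.extendOfNorm (UniformSpace.Completion.toComplL : V →L[ℂ] _).toLinearMap v
      = f v := fun v =>
    LinearMap.extendOfNorm_eq (e := (UniformSpace.Completion.toComplL : V →L[ℂ] _).toLinearMap)
      UniformSpace.Completion.denseRange_coe ⟨1, hnorm⟩ v
  refine ⟨f.extendOfNorm (UniformSpace.Completion.toComplL : V →L[ℂ] _).toLinearMap, hW,
    fun ξ η => ?_⟩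
  induction ξ, η using UniformSpace.Completion.induction_on₂ with
  | hp => exact isClosed_eq (by fun_prop) (by fun_prop)
  | ih v w => rw [hW, hW, hf, UniformSpace.Completion.inner_coe]

/-- The first leg is expanded in the basis b; preservation of inner products is Parseval's identity.
-/
theorem exists_slice_map {ι : Type u} (b : HilbertBasis ι ℂ E) :
    ∃ f : E ⊗[ℂ] H →ₗ[ℂ] lp (fun _ : ι => H) 2,
      (∀ x y i, f (x ⊗ₜ y) i = inner ℂ (b i) x • y) ∧
      ∀ v w, inner ℂ (f v) (f w) = inner ℂ v w := by
  have hmem : ∀ x (y : H), Memℓp (E := fun _ : ι => H) (fun i => inner ℂ (b i) x • y) 2 := by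
    intro x y
    have h := ((lp.memℓp (b.repr x)).norm.const_mul ‖y‖)
    refine Memℓp.of_norm (h.mono fun i => ?_)
    simp [norm_smul, mul_comm, b.repr_apply_apply]
  let f : E ⊗[ℂ] H →ₗ[ℂ] lp (fun _ : ι => H) 2 := TensorProduct.lift <|
    LinearMap.mk₂ ℂ (fun x y => ⟨fun i => inner ℂ (b i) x • y, hmem x y⟩)
      (fun x x' y => by ext i; simp [add_smul]; rfl)
      (fun c x y => by ext i; simp [mul_smul])
      (fun x y y' => by ext i; simp; rfl)
      (fun c x y => by ext i; simp [smul_comm c])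
  have hf : ∀ x y i, f (x ⊗ₜ y) i = inner ℂ (b i) x • y := fun x y i => rfl
  refine ⟨f, hf, fun v w => ?_⟩
  induction v with
  | zero => simp
  | add v v' hv hv' => simp [inner_add_left, hv, hv']
  | tmul x y =>
    induction w with
    | zero => simp
    | add w w' hw hw' => simp [inner_add_right, hw, hw']
    | tmul x' y' =>
      refine (lp.hasSum_inner _ _).unique ?_
      rw [TensorProduct.inner_tmul]
      convert! (b.hasSum_inner_mul_inner x x').mul_right (inner ℂ y y') using 2 with i
      rw [hf, hf, inner_smul_left, inner_smul_right, inner_conj_symm, mul_assoc]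

variable [CompleteSpace E] [CompleteSpace H]

/-- The Hilbert space tensor product `E ⊗ H` as a Hilbert sum of copies of `H`. -/
theorem exists_slices_right : ∃ (ι : Type u) (W : HilbertTensor E H →L[ℂ] lp (fun _ : ι => H) 2),
    (∀ ξ η, inner ℂ (W ξ) (W η) = inner ℂ ξ η) ∧
      ∀ (s : H →L[ℂ] H) ζ, W (tensorOp 1 s ζ) = amplification ι s (W ζ) := by
  obtain ⟨w, b, -⟩ := exists_hilbertBasis ℂ E
  obtain ⟨f, hf, hinner⟩ := exists_slice_map (H := H) b
  obtain ⟨W, hW, hWi⟩ := exists_extension_preserving_inner f hinner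
  refine ⟨w, W, hWi, fun s => hilbertTensor_induction (by fun_prop) (by fun_prop) (by simp)
    (fun x y => by simp) (fun x y => by simp) fun x y => ?_⟩
  ext i
  rw [tensorOp_tmul, hW, hW, amplification_apply, hf, hf]
  simp

/-- The Hilbert space tensor product `H ⊗ E` as a Hilbert sum of copies of `H`. -/
theorem exists_slices_left : ∃ (ι : Type u) (W : HilbertTensor H E →L[ℂ] lp (fun _ : ι => H) 2),
    (∀ ξ η, inner ℂ (W ξ) (W η) = inner ℂ ξ η) ∧
      ∀ (s : H →L[ℂ] H) ζ, W (tensorOp s 1 ζ) = amplification ι s (W ζ) := by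
  obtain ⟨w, b, -⟩ := exists_hilbertBasis ℂ E
  obtain ⟨f, hf, hinner⟩ := exists_slice_map (H := H) b
  obtain ⟨W, hW, hWi⟩ := exists_extension_preserving_inner
    (f ∘ₗ (TensorProduct.comm ℂ H E).toLinearMap) fun v w => by simp [hinner]
  refine ⟨w, W, hWi, fun s => hilbertTensor_induction (by fun_prop) (by fun_prop) (by simp)
    (fun x y => by simp) (fun x y => by simp) fun x y => ?_⟩
  ext i
  rw [tensorOp_tmul, hW, hW, amplification_apply]
  simp [hf]

end Slices

/-! ### Normality of restrictions to the tensor factors. -/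

namespace VonNeumannAlgebra

variable {H : Type u} [NormedAddCommGroup H] [InnerProductSpace ℂ H] [CompleteSpace H]
  {K : Type v} [NormedAddCommGroup K] [InnerProductSpace ℂ K] [CompleteSpace K]
  {M : VonNeumannAlgebra H} {N : VonNeumannAlgebra K}

/-- Normal functionals pull back to normal functionals along multiples of the identity
representation. -/
theorem IsNormalFunctional.comp_of_amplification {φ : N → ℂ} (hφ : N.IsNormalFunctional φ)
    {ι : Type w} (W : K →L[ℂ] lp (fun _ : ι => H) 2)
    (hW : ∀ ξ η, inner ℂ (W ξ) (W η) = inner ℂ ξ η) (π : M → N)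
    (hπ : ∀ a ζ, W ((π a : K →L[ℂ] K) ζ) = amplification ι (a : H →L[ℂ] H) (W ζ)) :
    M.IsNormalFunctional fun a => φ (π a) := by
  obtain ⟨ξ, η, hξ, hη, h⟩ := hφ
  have hsq : ∀ ζ : K, HasSum (fun i => ‖W ζ i‖ ^ 2) (‖ζ‖ ^ 2) := by
    intro ζ
    have : ‖W ζ‖ = ‖ζ‖ := by
      rw [norm_eq_sqrt_re_inner (𝕜 := ℂ), hW, ← norm_eq_sqrt_re_inner]
    simpa [this] using lp.hasSum_norm (p := 2) (by simp) (W ζ)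
  have hsum : ∀ ζ : ℕ → K, Summable (fun n => ‖ζ n‖ ^ 2) →
      Summable fun p : ℕ × ι => ‖W (ζ p.1) p.2‖ ^ 2 := by
    intro ζ hζ
    refine (summable_prod_of_nonneg (f := fun p : ℕ × ι => ‖W (ζ p.1) p.2‖ ^ 2)
      fun _ => sq_nonneg _).mpr ⟨fun n => (hsq (ζ n)).summable, ?_⟩
    exact hζ.congr fun n => (hsq (ζ n)).tsum_eq.symm
  refine isNormalFunctional_of_hasSum (fun p : ℕ × ι => W (ξ p.1) p.2)
    (fun p : ℕ × ι => W (η p.1) p.2) (hsum ξ hξ) (hsum η hη) fun a => ?_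
  have hfib : ∀ n, HasSum (fun i => inner ℂ (W (ξ n) i) ((a : H →L[ℂ] H) (W (η n) i)))
      (inner ℂ (ξ n) ((π a : K →L[ℂ] K) (η n))) := by
    intro n
    rw [← hW, hπ]
    simpa using lp.hasSum_inner (𝕜 := ℂ) (W (ξ n)) (amplification ι (a : H →L[ℂ] H) (W (η n)))
  -- Absolute summability over ℕ × ι allows the double sum to be evaluated fibre by fibre.
  have hsummable : Summable fun p : ℕ × ι =>
      inner ℂ (W (ξ p.1) p.2) ((a : H →L[ℂ] H) (W (η p.1) p.2)) := by
    refine Summable.of_norm_bounded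
      (((hsum ξ hξ).add (hsum η hη)).mul_left ‖(a : H →L[ℂ] H)‖) fun p => ?_
    calc _ ≤ ‖W (ξ p.1) p.2‖ * (‖(a : H →L[ℂ] H)‖ * ‖W (η p.1) p.2‖) :=
          (norm_inner_le_norm _ _).trans (by gcongr; exact ContinuousLinearMap.le_opNorm _ _)
      _ = ‖(a : H →L[ℂ] H)‖ * (‖W (ξ p.1) p.2‖ * ‖W (η p.1) p.2‖) := by ring
      _ ≤ _ := by
        gcongr
        nlinarith [sq_nonneg (‖W (ξ p.1) p.2‖ - ‖W (η p.1) p.2‖),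
          sq_nonneg ‖W (ξ p.1) p.2‖, sq_nonneg ‖W (η p.1) p.2‖]
  have := (hsummable.hasSum.prod_fiberwise hfib).unique (h (π a))
  rw [← this]
  exact hsummable.hasSum

/-- On H ⊗ K the operator a ⊗ 1 is a multiple of a. This is what makes the restriction to the first
factor of a bimodule over the tensor product normal again. -/
theorem IsNormalFunctional.comp_tmul_one {φ : M.tensor N → ℂ}
    (hφ : (M.tensor N).IsNormalFunctional φ) :
    M.IsNormalFunctional fun a => φ (tmul a (1 : N)) := by
  obtain ⟨ι, W, hW, h⟩ := exists_slices_left (E := K) (H := H)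
  exact hφ.comp_of_amplification W hW (fun a => tmul a (1 : N)) fun a ζ => h a ζ

theorem IsNormalFunctional.comp_one_tmul {φ : M.tensor N → ℂ}
    (hφ : (M.tensor N).IsNormalFunctional φ) :
    N.IsNormalFunctional fun b => φ (tmul (1 : M) b) := by
  obtain ⟨ι, W, hW, h⟩ := exists_slices_right (E := H) (H := K)
  exact hφ.comp_of_amplification W hW (fun b => tmul (1 : M) b) fun b ζ => h b ζ

end VonNeumannAlgebra

/-! ### Matrix units and relative commutants -/

/-- A system of `k × k` matrix units in a ring. -/
structure MatrixUnits (A : Type*) [Ring A] (k : ℕ) where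
  e : Fin k → Fin k → A
  mul : ∀ i j l m, e i j * e l m = if j = l then e i m else 0
  sum_diag : ∑ i, e i i = 1

namespace MatrixUnits

variable {A : Type*} [Ring A] {k : ℕ} (E : MatrixUnits A k)

/-- The entry `∑ i, e i p * x * e q i`, which commutes with the matrix units. -/
def entry (x : A) (p q : Fin k) : A := ∑ i, E.e i p * x * E.e q i

/-- Only the summand i = b survives. The result coincides with that of `entry_mul_e`, which is why
the entries commute with the matrix units. -/
theorem e_mul_entry (x : A) (p q a b : Fin k) : E.e a b * E.entry x p q = E.e a p * x * E.e q b := by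
  simp [entry, Finset.mul_sum, ← mul_assoc, E.mul]

theorem entry_mul_e (x : A) (p q a b : Fin k) : E.entry x p q * E.e a b = E.e a p * x * E.e q b := by
  simp [entry, Finset.sum_mul, mul_assoc, E.mul]

/-- The (p, q) term is e_pp x e_qq. Thus every element is a matrix with coefficients in the
commutant of the matrix units. -/
theorem sum_e_mul_entry (x : A) : ∑ p, ∑ q, E.e p q * E.entry x p q = x := by
  simp_rw [e_mul_entry, ← Finset.mul_sum, E.sum_diag, mul_one, ← Finset.sum_mul, E.sum_diag,
    one_mul]

end MatrixUnits

namespace VonNeumannAlgebra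

variable {H : Type u} [NormedAddCommGroup H] [InnerProductSpace ℂ H] [CompleteSpace H]
  {R : VonNeumannAlgebra H}

/-- The inclusion of a von Neumann algebra in the bounded operators. -/
noncomputable def subtypeHom (R : VonNeumannAlgebra H) : R →⋆ₐ[ℂ] (H →L[ℂ] H) := R.toStarSubalgebra.subtype

/-- An increasing sequence of matrix subalgebras of `R`, generating `R`. -/
structure MatrixFiltration (R : VonNeumannAlgebra H) where
  B : ℕ → StarSubalgebra ℂ R
  mono : Monotone B
  k : ℕ → ℕ
  units : ∀ n, MatrixUnits R (k n)
  exists_eq_sum : ∀ n, ∀ a ∈ B n, ∃ c : Fin (k n) → Fin (k n) → ℂ,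
    a = ∑ i, ∑ j, c i j • (units n).e i j
  e_mem : ∀ n i j, (units n).e i j ∈ B n
  union : StarSubalgebra ℂ (H →L[ℂ] H)
  mem_union : ∀ a : R, (a : H →L[ℂ] H) ∈ union ↔ ∃ n, a ∈ B n
  centralizer_centralizer_union :
    Set.centralizer (Set.centralizer (union : Set (H →L[ℂ] H))) = R

/-- The matrix units are the images of the standard ones; they sum to the identity of `R` because
the matrix subalgebras are unital. The union of an increasing sequence of star subalgebras is
already a star subalgebra, so its double commutant is the generated von Neumann algebra. -/
theorem IsHyperfiniteII1Factor.nonempty_matrixFiltration (hR : R.IsHyperfiniteII1Factor) :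
    Nonempty R.MatrixFiltration := by
  obtain ⟨-, A, k, hmono, hmat, hgen⟩ := hR
  have hsub : ∀ n, ∀ a ∈ A n, a ∈ R := fun n a ha => by
    rw [← hgen]
    exact subset_generatedBy _ (Set.mem_iUnion.mpr ⟨n, ha⟩)
  have hcoe : ((⨆ n, A n : StarSubalgebra ℂ (H →L[ℂ] H)) : Set (H →L[ℂ] H)) =
      ⋃ n, (A n : Set (H →L[ℂ] H)) := StarSubalgebra.coe_iSup_of_directed hmono.directed_le
  let φ := fun n => (hmat n).some
  let e : ∀ n, Fin (k n) → Fin (k n) → A n := fun n i j => (φ n).symm (Matrix.single i j 1)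
  let ι : ∀ n, A n → R := fun n a => ⟨a, hsub n a a.2⟩
  refine ⟨
    { B := fun n => (A n).comap R.subtypeHom
      mono := fun m n h a ha => hmono h ha
      k := k
      units := fun n =>
        { e := fun i j => ι n (e n i j)
          mul := fun i j l m => ?_
          sum_diag := ?_ }
      exists_eq_sum := fun n a ha => ?_
      e_mem := fun n i j => (e n i j).2
      union := ⨆ n, A n
      mem_union := fun a => ?_
      centralizer_centralizer_union := ?_ }⟩
  · have : e n i j * e n l m = if j = l then e n i m else 0 := by
      simp only [e, ← map_mul]
      split_ifs with h
      · subst h; simp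
      · rw [Matrix.single_mul_single_of_ne _ _ _ _ h, map_zero]
    refine Subtype.ext ((congrArg Subtype.val this).trans ?_)
    split_ifs <;> rfl
  · have : ∑ i, e n i i = 1 := by
      simp only [e, ← map_sum]
      rw [show ∑ i, Matrix.single i i (1 : ℂ) = (1 : Matrix (Fin (k n)) (Fin (k n)) ℂ) by
        
        ext i j
        rw [Matrix.sum_apply, Finset.sum_eq_single i (fun l _ hl => by simp [hl])
          (by simp)]
        simp [Matrix.single_apply, Matrix.one_apply], map_one]
    refine Subtype.ext (Eq.trans ?_ (congrArg (Subtype.val : A n → H →L[ℂ] H) this))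
    simp [ι]
  · obtain ⟨a, rfl⟩ : ∃ a' : A n, a = ι n a' := ⟨⟨a, ha⟩, rfl⟩
    refine ⟨φ n a, ?_⟩
    have : a = ∑ i, ∑ j, φ n a i j • e n i j := by
      conv_lhs => rw [← (φ n).symm_apply_apply a, Matrix.matrix_eq_sum_single (φ n a)]
      simp only [map_sum, e, ← map_smul]
      simp
    refine Subtype.ext ((congrArg Subtype.val this).trans ?_)
    simp [ι]
  · rw [← SetLike.mem_coe, hcoe]
    simp [StarSubalgebra.mem_comap]
    rfl
  · have hstar : star (⋃ n, (A n : Set (H →L[ℂ] H))) = ⋃ n, (A n : Set (H →L[ℂ] H)) := by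
      rw [← hcoe, StarMemClass.star_coe_eq]
    rw [hcoe, ← hgen]
    change _ = (StarSubalgebra.centralizer ℂ ((StarSubalgebra.centralizer ℂ
      (⋃ n, (A n : Set (H →L[ℂ] H))) : StarSubalgebra ℂ (H →L[ℂ] H)) : Set (H →L[ℂ] H)) :
        Set (H →L[ℂ] H))
    rw [StarSubalgebra.coe_centralizer_centralizer, hstar, Set.union_self]

namespace MatrixFiltration

variable (F : R.MatrixFiltration)

/-- The relative commutant of the `n`-th matrix algebra. -/
noncomputable def relCommutant (n : ℕ) : StarSubalgebra ℂ R :=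
  StarSubalgebra.centralizer ℂ (F.B n : Set R)

theorem mem_relCommutant {n : ℕ} {x : R} : x ∈ F.relCommutant n ↔ ∀ a ∈ F.B n, a * x = x * a := by
  rw [relCommutant, StarSubalgebra.mem_centralizer_iff]
  exact ⟨fun h a ha => (h a ha).1, fun h a ha => ⟨h a ha, h _ (star_mem ha)⟩⟩

theorem mem_relCommutant_of_units {n : ℕ} {x : R}
    (h : ∀ i j, (F.units n).e i j * x = x * (F.units n).e i j) : x ∈ F.relCommutant n := by
  rw [mem_relCommutant]
  intro a ha
  obtain ⟨c, rfl⟩ := F.exists_eq_sum n a ha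
  simp [Finset.sum_mul, Finset.mul_sum, h]

theorem isClosed_relCommutant (n : ℕ) : IsClosed (F.relCommutant n : Set R) := by
  rw [relCommutant, StarSubalgebra.coe_centralizer]
  exact Set.isClosed_centralizer _

theorem entry_mem_relCommutant (n : ℕ) (x : R) (p q) :
    (F.units n).entry x p q ∈ F.relCommutant n :=
  F.mem_relCommutant_of_units fun i j => by
    rw [MatrixUnits.e_mul_entry, MatrixUnits.entry_mul_e]

theorem exists_norm_toL2_sub_lt (τ : R.TracialState) (x : R) {ε : ℝ} (hε : 0 < ε) :
    ∃ n, ∃ a ∈ F.B n, ‖τ.toL2 (x - a)‖ < ε := by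
  obtain ⟨a, ha, h⟩ := τ.exists_norm_toL2_sub_lt F.centralizer_centralizer_union x hε
  obtain ⟨n, hn⟩ := (F.mem_union a).mp ha
  exact ⟨n, a, hn, h⟩

/-- An m in `R` is 2-norm close to some a in `B N`, and `x n` commutes with a once n ≥ N. The error
is at most 2C‖m - a‖₂ since the norms of the `x n` are bounded by C. -/
theorem isCentralSequence (τ : R.TracialState) {x : ℕ → R} {C : ℝ} (hC : ∀ n, ‖x n‖ ≤ C)
    (hx : ∀ n, x n ∈ F.relCommutant n) : τ.IsCentralSequence x := by
  refine ⟨⟨C, hC⟩, fun m => ?_⟩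
  have hC0 : 0 ≤ C := (norm_nonneg _).trans (hC 0)
  rw [Metric.tendsto_atTop]
  intro ε hε
  obtain ⟨N, a, ha, h⟩ := F.exists_norm_toL2_sub_lt τ m (ε := ε / (2 * C + 1)) (by positivity)
  refine ⟨N, fun n hn => ?_⟩
  have hcomm := F.mem_relCommutant.mp (hx n) a (F.mono hn ha)
  have heq : x n * m - m * x n = x n * (m - a) - (m - a) * x n := by
    rw [mul_sub, sub_mul, hcomm]
    abel
  rw [dist_zero_right, norm_norm, heq, TracialState.toL2_sub]
  calc _ ≤ C * ‖τ.toL2 (m - a)‖ + C * ‖τ.toL2 (m - a)‖ := by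
        refine (norm_sub_le _ _).trans (add_le_add ?_ ?_)
        · exact (τ.norm_toL2_mul_le _ _).trans (by gcongr; exact hC n)
        · exact (τ.norm_toL2_mul_le' _ _).trans (by gcongr; exact hC n)
    _ ≤ (2 * C + 1) * ‖τ.toL2 (m - a)‖ := by nlinarith [norm_nonneg (τ.toL2 (m - a))]
    _ < (2 * C + 1) * (ε / (2 * C + 1)) := by gcongr
    _ = ε := by field_simp

/-- Uniqueness of the trace. -/
theorem eq_trace_mul (F : R.MatrixFiltration) (τ : R.TracialState) (ψ : R →ₗ[ℂ] ℂ) (hψ : R.IsNormalFunctional ψ)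
    (htr : ∀ a b, ψ (a * b) = ψ (b * a)) (x : R) : ψ x = τ.toPositive x * ψ 1 := by
  have hnormal : R.IsNormalFunctional fun x => τ.toPositive x * ψ 1 := by
    obtain ⟨ξ, η, hξ, hη, h⟩ := τ.normal
    refine ⟨ξ, fun i => ψ 1 • η i, hξ, ?_, fun a => ?_⟩
    · simpa [norm_smul, mul_pow] using hη.mul_left (‖ψ 1‖ ^ 2)
    · simpa [inner_smul_right, mul_comm] using (h a).mul_left (ψ 1)
  refine congrFun (hψ.eq_of_eqOn hnormal F.centralizer_centralizer_union fun a ha => ?_) x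
  obtain ⟨n, hn⟩ := (F.mem_union a).mp ha
  obtain ⟨c, rfl⟩ := F.exists_eq_sum n a hn
  set E := F.units n
  -- On a full matrix algebra a trace kills the off-diagonal units and takes equal values on the
  -- diagonal ones, so it is fixed by its value at 1. The factor `F.k n` is kept on the left to
  -- avoid dividing.
  have hunit : ∀ (θ : R →ₗ[ℂ] ℂ), (∀ a b, θ (a * b) = θ (b * a)) →
      θ (∑ i, ∑ j, c i j • E.e i j) * F.k n = (∑ i, c i i) * θ 1 := by
    intro θ hθ
    have hoff : ∀ i j, i ≠ j → θ (E.e i j) = 0 := by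
      intro i j hij
      have := hθ (E.e i i) (E.e i j)
      rwa [E.mul, if_pos rfl, E.mul, if_neg hij.symm, map_zero] at this
    have hdiag : ∀ i j, θ (E.e i i) = θ (E.e j j) := by
      intro i j
      have := hθ (E.e i j) (E.e j i)
      rwa [E.mul, if_pos rfl, E.mul, if_pos rfl] at this
    have hone : ∀ i, θ 1 = F.k n * θ (E.e i i) := by
      intro i
      rw [← E.sum_diag, map_sum, Finset.sum_congr rfl fun j _ => hdiag j i]
      simp
    have hsum : θ (∑ i, ∑ j, c i j • E.e i j) = ∑ i, c i i * θ (E.e i i) := by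
      rw [map_sum]
      refine Finset.sum_congr rfl fun i _ => ?_
      rw [map_sum, Finset.sum_eq_single i (fun j _ hj => by rw [map_smul, hoff i j hj.symm, smul_zero])
        (by simp), map_smul, smul_eq_mul]
    rw [hsum, Finset.sum_mul, Finset.sum_mul]
    refine Finset.sum_congr rfl fun i _ => ?_
    rw [hone i]
    ring
  have hk : (F.k n : ℂ) ≠ 0 := by
    intro h0
    have hk0 : F.k n = 0 := by exact_mod_cast h0
    have : IsEmpty (Fin (F.k n)) := by rw [hk0]; infer_instance
    have h1 : (1 : R) = 0 := by rw [← E.sum_diag]; simp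
    have h2 := τ.map_one
    rw [h1, map_zero] at h2
    exact zero_ne_one h2
  have h1 := hunit ψ htr
  have h2 := hunit (τ.toPositive : R →ₗ[ℂ] ℂ) τ.tracial
  refine mul_right_cancel₀ hk (h1.trans ?_)
  have h3 : τ.toPositive (∑ i, ∑ j, c i j • E.e i j) * F.k n = (∑ i, c i i) * τ.toPositive 1 := h2
  rw [τ.map_one, mul_one] at h3
  rw [← h3]
  ring

end MatrixFiltration

end VonNeumannAlgebra

/-! ### Fixed vectors -/

/-- A family of linear isometries preserving a nonempty set has a common fixed vector in its closed
convex hull, namely the vector of least norm. -/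
theorem exists_fixed_mem_closure_convexHull {X : Type*} [NormedAddCommGroup X]
    [InnerProductSpace ℂ X] [CompleteSpace X] {O : Set X} (hO : O.Nonempty)
    (G : Set (X →L[ℂ] X)) (hnorm : ∀ g ∈ G, ∀ v, ‖g v‖ = ‖v‖) (hG : ∀ g ∈ G, Set.MapsTo g O O) :
    ∃ η ∈ closure (convexHull ℝ O), ∀ g ∈ G, g η = η := by
  let : InnerProductSpace ℝ X := InnerProductSpace.complexToReal
  have hconv : Convex ℝ (closure (convexHull ℝ O)) := (convex_convexHull ℝ O).closure
  obtain ⟨η, hη, hmin⟩ := exists_norm_eq_iInf_of_complete_convex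
    (hO.convexHull.closure) isClosed_closure.isComplete hconv (0 : X)
  refine ⟨η, hη, fun g hg => ?_⟩
  have hmaps : g η ∈ closure (convexHull ℝ O) := by
    refine map_mem_closure g.continuous hη fun v hv => ?_
    have := convexHull_min (s := O) (t := (g.restrictScalars ℝ) ⁻¹' convexHull ℝ O)
      (fun w hw => subset_convexHull ℝ O (hG g hg hw))
      ((convex_convexHull ℝ O).linear_preimage (g.restrictScalars ℝ).toLinearMap)
    exact this hv
  -- Both η and g η are points of least norm. Their two variational inequalities add up to ‖g η -
  -- η‖² ≤ 0.
  have h1 := (norm_eq_iInf_iff_real_inner_le_zero hconv hη).mp hmin _ hmaps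
  have h2 := (norm_eq_iInf_iff_real_inner_le_zero hconv hmaps).mp
    ((show ‖0 - g η‖ = ‖0 - η‖ by rw [zero_sub, zero_sub, norm_neg, norm_neg, hnorm g hg]).trans
      hmin) _ hη
  have h3 : ‖g η - η‖ ^ 2 ≤ 0 := by
    rw [← real_inner_self_eq_norm_sq]
    simp only [zero_sub, inner_neg_left, inner_sub_right, inner_sub_left] at h1 h2 ⊢
    linarith [real_inner_comm η (g η)]
  rw [← sub_eq_zero, ← norm_eq_zero]
  exact pow_eq_zero_iff (two_ne_zero) |>.mp (le_antisymm h3 (sq_nonneg _))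

/-! ### Centrally trivial bimodules over the hyperfinite factor -/

namespace HilbertBimodule

open VonNeumannAlgebra

variable {H : Type u} [NormedAddCommGroup H] [InnerProductSpace ℂ H] [CompleteSpace H]
  {R : VonNeumannAlgebra H}
  {X : Type w} [NormedAddCommGroup X] [InnerProductSpace ℂ X] [CompleteSpace X]

theorem left_mul_apply (α : HilbertBimodule R R X) (a b : R) (x : X) :
    α.left (a * b) x = α.left a (α.left b x) := by
  rw [map_mul]; rfl

theorem right_mul_apply (α : HilbertBimodule R R X) (a b : R) (x : X) :
    α.right (op (a * b)) x = α.right (op b) (α.right (op a) x) := by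
  rw [op_mul, map_mul]; rfl

theorem inner_left_left (α : HilbertBimodule R R X) (a : R) (x y : X) :
    inner ℂ (α.left a x) y = inner ℂ x (α.left (star a) y) := by
  rw [map_star, ContinuousLinearMap.star_eq_adjoint, ContinuousLinearMap.adjoint_inner_right]

theorem inner_right_left (α : HilbertBimodule R R X) (a : R) (x y : X) :
    inner ℂ (α.right (op a) x) y = inner ℂ x (α.right (op (star a)) y) := by
  rw [op_star, map_star, ContinuousLinearMap.star_eq_adjoint,
    ContinuousLinearMap.adjoint_inner_right]

/-- The vectors commuting with the coefficient algebra. -/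
def centralVectors (α : HilbertBimodule R R X) : Submodule ℂ X where
  carrier := {x | ∀ r : R, α.left r x = α.right (op r) x}
  add_mem' hx hy r := by simp [hx r, hy r]
  zero_mem' r := by simp
  smul_mem' c x hx r := by simp [hx r]

theorem isClosed_centralVectors (α : HilbertBimodule R R X) :
    IsClosed (α.centralVectors : Set X) := by
  have : (α.centralVectors : Set X) = ⋂ r : R, {x | α.left r x = α.right (op r) x} := by
    ext x; simp [centralVectors]
  rw [this]
  exact isClosed_iInter fun r => isClosed_eq (by fun_prop) (by fun_prop)

instance (α : HilbertBimodule R R X) : CompleteSpace α.centralVectors :=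
  α.isClosed_centralVectors.completeSpace_coe

variable (F : R.MatrixFiltration) {τ : R.TracialState} {α : HilbertBimodule R R X}

/-- If every n failed, choosing a bad element of the unit ball of each relative commutant would give
a central sequence that violates central triviality at ξ. -/
theorem IsCentrallyTrivial.exists_uniform (hα : α.IsCentrallyTrivial τ) (ξ : X) {ε : ℝ}
    (hε : 0 < ε) : ∃ n, ∀ x ∈ F.relCommutant n, ‖x‖ ≤ 1 →
      ‖α.left x ξ - α.right (op x) ξ‖ ≤ ε := by
  by_contra! h
  choose x hx hx1 hxε using h
  have := (hα x (F.isCentralSequence τ hx1 hx) ξ).eventually_lt_const hε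
  obtain ⟨n, hn⟩ := this.exists
  exact absurd hn (hxε n).not_gt

theorem left_mem_unitary (α : HilbertBimodule R R X) {u : R} (hu : u ∈ unitary R) :
    α.left u ∈ unitary (X →L[ℂ] X) := Unitary.map_mem α.left hu

theorem right_mem_unitary (α : HilbertBimodule R R X) {u : R} (hu : u ∈ unitary R) :
    α.right (op u) ∈ unitary (X →L[ℂ] X) := by
  refine Unitary.map_mem α.right ?_
  rw [Unitary.mem_iff, ← op_star, ← op_mul, ← op_mul, Unitary.mul_star_self_of_mem hu,
    Unitary.star_mul_self_of_mem hu]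
  exact ⟨rfl, rfl⟩

/-- Vectors that almost commute with the unit ball of a relative commutant are close to vectors
which commute with it. -/
theorem exists_commuting_near (n : ℕ) (ξ : X) {ε : ℝ}
    (h : ∀ x ∈ F.relCommutant n, ‖x‖ ≤ 1 → ‖α.left x ξ - α.right (op x) ξ‖ ≤ ε) :
    ∃ η, ‖η - ξ‖ ≤ ε ∧ ∀ x ∈ F.relCommutant n, α.left x η = α.right (op x) η := by
  set G : Set (X →L[ℂ] X) := {g | ∃ u ∈ F.relCommutant n, u ∈ unitary R ∧
    g = α.left u * α.right (op (star u))} with hGdef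
  obtain ⟨η, hη, hfix⟩ := exists_fixed_mem_closure_convexHull (O := (fun g => g ξ) '' G)
    ⟨_, 1, ⟨1, one_mem _, one_mem _, by simp⟩, rfl⟩ G
    (by
      rintro _ ⟨u, -, hu, rfl⟩ v
      exact ContinuousLinearMap.norm_map_of_mem_unitary
        (mul_mem (α.left_mem_unitary hu) (α.right_mem_unitary (Unitary.star_mem hu))) v)
    (by
      rintro _ ⟨u, hun, hu, rfl⟩ _ ⟨_, ⟨v, hvn, hv, rfl⟩, rfl⟩
      refine ⟨_, ⟨u * v, mul_mem hun hvn, mul_mem hu hv, rfl⟩, ?_⟩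
      simp only [mul_apply_eq_comp, star_mul, left_mul_apply, right_mul_apply,
        α.commute])
  refine ⟨η, ?_, fun x hx => ?_⟩
  · have hball : closure (convexHull ℝ ((fun g => g ξ) '' G)) ⊆ Metric.closedBall ξ ε := by
      refine closure_minimal (convexHull_min ?_ (convex_closedBall ξ ε)) Metric.isClosed_closedBall
      rintro _ ⟨_, ⟨u, hun, hu, rfl⟩, rfl⟩
      rw [mem_closedBall_iff_norm]
      -- uξu* - ξ = (uξ - ξu)u*, and right multiplication by u* is isometric; so the whole orbit
      -- lies in the ball of radius ε.
      have h1 : (α.left u * α.right (op (star u))) ξ - ξ =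
          α.right (op (star u)) (α.left u ξ - α.right (op u) ξ) := by
        rw [map_sub, ← right_mul_apply, Unitary.mul_star_self_of_mem hu, op_one, map_one,
          mul_apply_eq_comp, α.commute]
        rfl
      have hu1 : ‖u‖ ≤ 1 := by
        have h2 : ‖u‖ * ‖u‖ ≤ 1 := by
          rw [← CStarRing.norm_star_mul_self, Unitary.star_mul_self_of_mem hu]
          exact ContinuousLinearMap.norm_id_le
        nlinarith [norm_nonneg u]
      simp only []
      rw [h1, ContinuousLinearMap.norm_map_of_mem_unitary
        (α.right_mem_unitary (Unitary.star_mem hu))]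
      exact h u hun hu1
    exact mem_closedBall_iff_norm.mp (hball hη)
  · have hunit : ∀ u ∈ F.relCommutant n, u ∈ unitary R → α.left u η = α.right (op u) η := by
      intro u hun hu
      have h1 := hfix _ ⟨u, hun, hu, rfl⟩
      rw [mul_apply_eq_comp, α.commute] at h1
      have h2 := congrArg (α.right (op u)) h1
      rwa [← right_mul_apply, Unitary.star_mul_self_of_mem hu, op_one, map_one] at h2
    -- The relative commutant is a C*-algebra, so its elements are linear combinations of four of
    -- its own unitaries, with which η commutes.
    let _ : CStarAlgebra (F.relCommutant n) :=
      StarSubalgebra.cstarAlgebra (F.relCommutant n) (h_closed := F.isClosed_relCommutant n)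
    obtain ⟨v, c, hv, -⟩ := CStarAlgebra.exists_sum_four_unitary (⟨x, hx⟩ : F.relCommutant n)
    have hx' : x = ∑ i, c i • ((v i : F.relCommutant n) : R) := by
      simpa using congrArg Subtype.val hv
    have hvu : ∀ i, ((v i : F.relCommutant n) : R) ∈ unitary R := fun i =>
      Unitary.map_mem (F.relCommutant n).subtype (v i).2
    rw [hx', map_sum, sum_apply, Finset.op_sum, map_sum,
      sum_apply]
    refine Finset.sum_congr rfl fun i _ => ?_
    rw [map_smul, op_smul, map_smul, smul_apply,
      smul_apply, hunit _ (v i : F.relCommutant n).2 (hvu i)]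

/-- A vector commuting with matrix units and with their relative commutant is central. -/
theorem mem_centralVectors_of_commute (n : ℕ) {ζ : X}
    (h : ∀ x ∈ F.relCommutant n, α.left x ζ = α.right (op x) ζ)
    (he : ∀ i j, α.left ((F.units n).e i j) ζ = α.right (op ((F.units n).e i j)) ζ) :
    ζ ∈ α.centralVectors := by
  intro r
  rw [← (F.units n).sum_e_mul_entry r]
  simp only [map_sum, Finset.op_sum, sum_apply]
  refine Finset.sum_congr rfl fun p _ => Finset.sum_congr rfl fun q _ => ?_
  rw [left_mul_apply, right_mul_apply, h _ (F.entry_mem_relCommutant n r p q), α.commute, he]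

/-- A vector commuting with the relative commutant of a matrix algebra is a combination of
central vectors. -/
theorem mem_span_of_commute (n : ℕ) {η : X}
    (h : ∀ x ∈ F.relCommutant n, α.left x η = α.right (op x) η) :
    η ∈ Submodule.span ℂ {v | ∃ a : R, ∃ k ∈ α.centralVectors, v = α.left a k} := by
  set E := F.units n
  -- These are the analogues of `MatrixUnits.entry` for a vector: Σ_i e_ip η e_qi, which commutes
  -- with the matrix units for the same reason.
  set ent : Fin (F.k n) → Fin (F.k n) → X := fun p q =>
    ∑ i, α.left (E.e i p) (α.right (op (E.e q i)) η) with hent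
  have hleft : ∀ a b p q, α.left (E.e a b) (ent p q) =
      α.left (E.e a p) (α.right (op (E.e q b)) η) := by
    intro a b p q
    simp only [hent, map_sum, ← left_mul_apply, E.mul]
    rw [Finset.sum_eq_single b (fun i _ hi => by simp [hi.symm]) (by simp)]
    simp
  have hright : ∀ a b p q, α.right (op (E.e a b)) (ent p q) =
      α.left (E.e a p) (α.right (op (E.e q b)) η) := by
    intro a b p q
    simp only [hent, map_sum, ← α.commute, ← right_mul_apply, E.mul]
    rw [Finset.sum_eq_single a (fun i _ hi => by simp [hi]) (by simp)]
    simp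
  have hcentral : ∀ p q, ent p q ∈ α.centralVectors := by
    intro p q
    refine mem_centralVectors_of_commute F n (fun x hx => ?_) fun i j => by rw [hleft, hright]
    simp only [hent, map_sum]
    refine Finset.sum_congr rfl fun i _ => ?_
    have hx1 := F.mem_relCommutant.mp hx _ (F.e_mem n i p)
    have hx2 := F.mem_relCommutant.mp hx _ (F.e_mem n q i)
    rw [← left_mul_apply, ← hx1, left_mul_apply, ← α.commute, ← right_mul_apply, hx2,
      right_mul_apply, α.commute x, h x hx]
  have hsum : η = ∑ p, ∑ q, α.left (E.e p q) (ent p q) := by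
    have hl : ∀ y, ∑ p, α.left (E.e p p) y = y := fun y => by
      rw [← sum_apply, ← map_sum, E.sum_diag, map_one]; rfl
    have hr : ∀ y, ∑ p, α.right (op (E.e p p)) y = y := fun y => by
      rw [← sum_apply, ← map_sum, ← Finset.op_sum, E.sum_diag, op_one, map_one]; rfl
    simp only [hleft, ← map_sum, hr, hl]
  rw [hsum]
  exact Submodule.sum_mem _ fun p _ => Submodule.sum_mem _ fun q _ =>
    Submodule.subset_span ⟨_, _, hcentral p q, rfl⟩

theorem IsCentrallyTrivial.dense_span (F : R.MatrixFiltration) (hα : α.IsCentrallyTrivial τ) :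
    Dense (Submodule.span ℂ {v | ∃ a : R, ∃ k ∈ α.centralVectors, v = α.left a k} : Set X) := by
  intro ξ
  rw [Metric.mem_closure_iff]
  intro ε hε
  obtain ⟨n, hn⟩ := hα.exists_uniform F ξ (half_pos hε)
  obtain ⟨η, hη, hcomm⟩ := exists_commuting_near F n ξ hn
  refine ⟨η, mem_span_of_commute F n hcomm, ?_⟩
  rw [dist_comm, dist_eq_norm]
  linarith

/-- On central vectors the matrix coefficients are multiples of the trace. -/
theorem inner_left_left_central (F : R.MatrixFiltration) (τ : R.TracialState) {k k' : X} (hk : k ∈ α.centralVectors)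
    (hk' : k' ∈ α.centralVectors) (a b : R) :
    inner ℂ (α.left a k) (α.left b k') = inner ℂ (τ.toL2 a) (τ.toL2 b) * inner ℂ k k' := by
  let ψ : R →ₗ[ℂ] ℂ :=
    { toFun := fun a => inner ℂ k (α.left a k')
      map_add' := fun a b => by simp
      map_smul' := fun c a => by simp }
  have htr : ∀ a b, ψ (a * b) = ψ (b * a) := by
    intro a b
    change inner ℂ k (α.left (a * b) k') = inner ℂ k (α.left (b * a) k')
    -- Centrality is used at both ends: ⟪k, a b k'⟫ = ⟪k, a k' b⟫ = ⟪k b*, a k'⟫ = ⟪b* k, a k'⟫ =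
    -- ⟪k, b a k'⟫.
    rw [left_mul_apply, hk' b, α.commute, ← star_star b, ← inner_right_left, ← hk,
      inner_left_left, star_star, left_mul_apply]
  have h := F.eq_trace_mul τ ψ (α.left_normal k k') htr (star a * b)
  rw [inner_left_left, ← left_mul_apply, τ.inner_toL2]
  refine h.trans ?_
  change _ * inner ℂ k (α.left 1 k') = _
  rw [map_one]
  rfl

end HilbertBimodule

/-! ### Bimodules over tensor products -/

section TensorOp

variable {H : Type u} [NormedAddCommGroup H] [InnerProductSpace ℂ H]
  {K : Type v} [NormedAddCommGroup K] [InnerProductSpace ℂ K]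

theorem tensorOp_ext {Y : Type*} [NormedAddCommGroup Y] [NormedSpace ℂ Y]
    {S T : HilbertTensor H K →L[ℂ] Y}
    (h : ∀ x y, S ((x ⊗ₜ[ℂ] y : H ⊗[ℂ] K) : HilbertTensor H K) =
      T ((x ⊗ₜ[ℂ] y : H ⊗[ℂ] K) : HilbertTensor H K)) : S = T :=
  ContinuousLinearMap.ext <| hilbertTensor_induction S.continuous T.continuous (by simp)
    (map_add S) (map_add T) h

theorem tensorOp_one : tensorOp (1 : H →L[ℂ] H) (1 : K →L[ℂ] K) = 1 :=
  tensorOp_ext fun x y => by rw [tensorOp_tmul]; rfl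

theorem tensorOp_mul (a a' : H →L[ℂ] H) (b b' : K →L[ℂ] K) :
    tensorOp (a * a') (b * b') = tensorOp a b * tensorOp a' b' :=
  tensorOp_ext fun x y => by
    rw [mul_apply_eq_comp, tensorOp_tmul, tensorOp_tmul, tensorOp_tmul]; rfl

theorem tensorOp_add_left (a a' : H →L[ℂ] H) (b : K →L[ℂ] K) :
    tensorOp (a + a') b = tensorOp a b + tensorOp a' b :=
  tensorOp_ext fun x y => by
    rw [add_apply, tensorOp_tmul, tensorOp_tmul, tensorOp_tmul, add_apply, TensorProduct.add_tmul,
      UniformSpace.Completion.coe_add]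

theorem tensorOp_add_right (a : H →L[ℂ] H) (b b' : K →L[ℂ] K) :
    tensorOp a (b + b') = tensorOp a b + tensorOp a b' :=
  tensorOp_ext fun x y => by
    rw [add_apply, tensorOp_tmul, tensorOp_tmul, tensorOp_tmul, add_apply, TensorProduct.tmul_add,
      UniformSpace.Completion.coe_add]

theorem tensorOp_smul_left (c : ℂ) (a : H →L[ℂ] H) (b : K →L[ℂ] K) :
    tensorOp (c • a) b = c • tensorOp a b :=
  tensorOp_ext fun x y => by
    rw [smul_apply, tensorOp_tmul, tensorOp_tmul, smul_apply, ← TensorProduct.smul_tmul',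
      UniformSpace.Completion.coe_smul]

theorem tensorOp_smul_right (c : ℂ) (a : H →L[ℂ] H) (b : K →L[ℂ] K) :
    tensorOp a (c • b) = c • tensorOp a b :=
  tensorOp_ext fun x y => by
    rw [smul_apply, tensorOp_tmul, tensorOp_tmul, smul_apply, TensorProduct.tmul_smul,
      UniformSpace.Completion.coe_smul]

theorem tensorOp_star [CompleteSpace H] [CompleteSpace K] (a : H →L[ℂ] H) (b : K →L[ℂ] K) :
    tensorOp (star a) (star b) = star (tensorOp a b) := by
  refine (ContinuousLinearMap.eq_adjoint_iff _ _).mpr fun ζ ω => ?_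
  refine hilbertTensor_induction (f := fun ζ => inner ℂ (tensorOp (star a) (star b) ζ) ω)
    (g := fun ζ => inner ℂ ζ (tensorOp a b ω)) (by fun_prop) (by fun_prop) (by simp)
    (by simp [inner_add_left]) (by simp [inner_add_left]) (fun x y => ?_) ζ
  refine hilbertTensor_induction (f := fun ω => inner ℂ (tensorOp (star a) (star b) _) ω)
    (g := fun ω => inner ℂ _ (tensorOp a b ω)) (by fun_prop) (by fun_prop) (by simp)
    (by simp [inner_add_right]) (by simp [inner_add_right]) (fun x' y' => ?_) ω
  simp only [tensorOp_tmul, UniformSpace.Completion.inner_coe, TensorProduct.inner_tmul,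
    ContinuousLinearMap.star_eq_adjoint, ContinuousLinearMap.adjoint_inner_left]

variable [CompleteSpace H] [CompleteSpace K]

namespace VonNeumannAlgebra

variable (M : VonNeumannAlgebra H) (N : VonNeumannAlgebra K)

theorem tmul_mul_tmul {M : VonNeumannAlgebra H} {N : VonNeumannAlgebra K} (a a' : M) (b b' : N) :
    tmul a b * tmul a' b' = tmul (a * a') (b * b') :=
  Subtype.ext (tensorOp_mul _ _ _ _).symm

/-- The embedding `a ↦ a ⊗ 1`. -/
noncomputable def tmulOneHom : M →⋆ₐ[ℂ] M.tensor N where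
  toFun a := tmul a 1
  map_one' := Subtype.ext tensorOp_one
  map_mul' a a' := by rw [tmul_mul_tmul, one_mul]
  map_zero' := Subtype.ext (by
    have := tensorOp_smul_left (0 : ℂ) (0 : H →L[ℂ] H) (1 : K →L[ℂ] K)
    rwa [zero_smul, zero_smul] at this)
  map_add' a a' := Subtype.ext (tensorOp_add_left _ _ _)
  commutes' c := Subtype.ext (by
    rw [Algebra.algebraMap_eq_smul_one, Algebra.algebraMap_eq_smul_one]
    exact (tensorOp_smul_left c 1 1).trans (congrArg _ tensorOp_one))
  map_star' a := Subtype.ext (by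
    refine Eq.trans ?_ (tensorOp_star (a : H →L[ℂ] H) (1 : K →L[ℂ] K))
    rw [star_one]
    rfl)

/-- The embedding `b ↦ 1 ⊗ b`. -/
noncomputable def oneTmulHom : N →⋆ₐ[ℂ] M.tensor N where
  toFun b := tmul 1 b
  map_one' := Subtype.ext tensorOp_one
  map_mul' b b' := by rw [tmul_mul_tmul, one_mul]
  map_zero' := Subtype.ext (by
    have := tensorOp_smul_right (0 : ℂ) (1 : H →L[ℂ] H) (0 : K →L[ℂ] K)
    rwa [zero_smul, zero_smul] at this)
  map_add' b b' := Subtype.ext (tensorOp_add_right _ _ _)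
  commutes' c := Subtype.ext (by
    rw [Algebra.algebraMap_eq_smul_one, Algebra.algebraMap_eq_smul_one]
    exact (tensorOp_smul_right c 1 1).trans (congrArg _ tensorOp_one))
  map_star' b := Subtype.ext (by
    refine Eq.trans ?_ (tensorOp_star (1 : H →L[ℂ] H) (b : K →L[ℂ] K))
    rw [star_one]
    rfl)

end VonNeumannAlgebra

end TensorOp

/-! ### Constructions on bimodules and the decomposition L²R ⊗ K. -/

namespace HilbertBimodule

open VonNeumannAlgebra

section Constructions

variable {H : Type u} [NormedAddCommGroup H] [InnerProductSpace ℂ H] [CompleteSpace H]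
  {K : Type v} [NormedAddCommGroup K] [InnerProductSpace ℂ K] [CompleteSpace K]
  {M : VonNeumannAlgebra H} {N : VonNeumannAlgebra K}
  {X : Type w} [NormedAddCommGroup X] [InnerProductSpace ℂ X] [CompleteSpace X]
  {Y : Type w'} [NormedAddCommGroup Y] [InnerProductSpace ℂ Y] [CompleteSpace Y]

/-- Restriction of scalars along a normal homomorphism. -/
noncomputable def comap (α : HilbertBimodule M M X) (π : N →⋆ₐ[ℂ] M)
    (hπ : ∀ φ, M.IsNormalFunctional φ → N.IsNormalFunctional fun b => φ (π b)) :
    HilbertBimodule N N X where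
  left := α.left.comp π
  right :=
    { toFun := fun b => α.right (op (π b.unop))
      map_one' := by simp
      map_mul' := fun a b => by rw [unop_mul, map_mul, op_mul, map_mul]
      map_zero' := by simp
      map_add' := fun a b => by rw [unop_add, map_add, op_add, map_add]
      commutes' := fun c => by
        rw [Algebra.algebraMap_eq_smul_one, unop_smul, unop_one, map_smul, map_one, op_smul, op_one,
          map_smul, map_one, Algebra.algebraMap_eq_smul_one]
      map_star' := fun a => by rw [unop_star, map_star, op_star, map_star] }
  commute a b x := α.commute (π a) (π b) x
  left_normal x y := hπ _ (α.left_normal x y)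
  right_normal x y := hπ _ (α.right_normal x y)

/-- Transport of a bimodule structure along a unitary. -/
noncomputable def transport (α : HilbertBimodule M N X) (U : X ≃ₗᵢ[ℂ] Y) :
    HilbertBimodule M N Y where
  left := (U.conjStarAlgEquiv : (X →L[ℂ] X) →⋆ₐ[ℂ] (Y →L[ℂ] Y)).comp α.left
  right := (U.conjStarAlgEquiv : (X →L[ℂ] X) →⋆ₐ[ℂ] (Y →L[ℂ] Y)).comp α.right
  commute a b y := by simp [α.commute]
  left_normal x y := by
    convert! α.left_normal (U.symm x) (U.symm y) using 2 with a
    rw [← U.inner_map_map]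
    simp
  right_normal x y := by
    convert! α.right_normal (U.symm x) (U.symm y) using 2 with a
    rw [← U.inner_map_map]
    simp

theorem transport_left_apply (α : HilbertBimodule M N X) (U : X ≃ₗᵢ[ℂ] Y) (a : M) (x : X) :
    (α.transport U).left a (U x) = U (α.left a x) := by
  simp [transport]

theorem transport_right_apply (α : HilbertBimodule M N X) (U : X ≃ₗᵢ[ℂ] Y) (b : N) (x : X) :
    (α.transport U).right (op b) (U x) = U (α.right (op b) x) := by
  simp [transport]

/-- A star homomorphism into the bounded operators restricts to an invariant closed subspace. -/
noncomputable def restrictHom {A : Type*} [Ring A] [StarRing A] [Algebra ℂ A]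
    (π : A →⋆ₐ[ℂ] (X →L[ℂ] X)) (V : Submodule ℂ X) [CompleteSpace V]
    (hV : ∀ a, ∀ x ∈ V, π a x ∈ V) : A →⋆ₐ[ℂ] (V →L[ℂ] V) where
  toFun a := (π a ∘L V.subtypeL).codRestrict V fun x => hV a x x.2
  map_one' := by ext x; simp
  map_mul' a b := by ext x; simp; rfl
  map_zero' := by ext x; simp
  map_add' a b := by ext x; simp; rfl
  commutes' c := by ext x; simp [Algebra.algebraMap_eq_smul_one]
  map_star' a := by
    refine (ContinuousLinearMap.eq_adjoint_iff _ _).mpr fun x y => ?_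
    change inner ℂ (π (star a) x) (y : X) = inner ℂ (x : X) (π a y)
    rw [map_star, ContinuousLinearMap.star_eq_adjoint, ContinuousLinearMap.adjoint_inner_left]

/-- The restriction of a bimodule to an invariant closed subspace. -/
noncomputable def restrict (α : HilbertBimodule M N X) (V : Submodule ℂ X) [CompleteSpace V]
    (hl : ∀ a, ∀ x ∈ V, α.left a x ∈ V) (hr : ∀ b, ∀ x ∈ V, α.right b x ∈ V) :
    HilbertBimodule M N V where
  left := restrictHom α.left V hl
  right := restrictHom α.right V hr
  commute a b x := Subtype.ext (α.commute a b x)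
  left_normal x y := α.left_normal x y
  right_normal x y := α.right_normal x y

end Constructions

section L2Tensor

variable {H : Type u} [NormedAddCommGroup H] [InnerProductSpace ℂ H] [CompleteSpace H]
  {R : VonNeumannAlgebra H} (τ : R.TracialState)
  {X : Type w} [NormedAddCommGroup X] [InnerProductSpace ℂ X] [CompleteSpace X]

/-- The map `a ⊗ k ↦ a k` on `R ⊗ V`, where `V` is a space of vectors. -/
noncomputable def actionMap (α : HilbertBimodule R R X) (V : Submodule ℂ X) :
    R ⊗[ℂ] V →ₗ[ℂ] X :=
  TensorProduct.lift <| LinearMap.mk₂ ℂ (fun (a : R) (k : V) => α.left a k)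
    (fun a b k => by simp) (fun c a k => by simp) (fun a k l => by simp) (fun c a k => by simp)

theorem actionMap_tmul (α : HilbertBimodule R R X) (V : Submodule ℂ X) (a : R) (k : V) :
    α.actionMap V (a ⊗ₜ k) = α.left a k := rfl

/-- The map `a ⊗ k ↦ a ⊗ k` from the algebraic tensor product `R ⊗ V` to `L²R ⊗ V`. -/
noncomputable def toL2Tensor (V : Type w) [NormedAddCommGroup V] [InnerProductSpace ℂ V] :
    R ⊗[ℂ] V →ₗ[ℂ] HilbertTensor τ.L2 V :=
  (UniformSpace.Completion.toComplL : (τ.L2 ⊗[ℂ] V) →L[ℂ] HilbertTensor τ.L2 V).toLinearMap ∘ₗ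
    TensorProduct.map τ.toL2ₗ LinearMap.id

theorem toL2Tensor_tmul (V : Type w) [NormedAddCommGroup V] [InnerProductSpace ℂ V] (a : R)
    (k : V) : toL2Tensor τ V (a ⊗ₜ k) =
      ((τ.toL2 a ⊗ₜ[ℂ] k : τ.L2 ⊗[ℂ] V) : HilbertTensor τ.L2 V) := rfl

theorem denseRange_toL2Tensor (V : Type w) [NormedAddCommGroup V] [InnerProductSpace ℂ V] :
    DenseRange (toL2Tensor τ V) := by
  set W := (LinearMap.range (toL2Tensor τ V)).topologicalClosure with hW
  have hmem : ∀ (x : τ.L2) (k : V),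
      ((x ⊗ₜ[ℂ] k : τ.L2 ⊗[ℂ] V) : HilbertTensor τ.L2 V) ∈ W := by
    intro x k
    have hcont : Continuous fun x : τ.L2 =>
        ((x ⊗ₜ[ℂ] k : τ.L2 ⊗[ℂ] V) : HilbertTensor τ.L2 V) :=
      (UniformSpace.Completion.continuous_coe _).comp
        (TensorProduct.continuous_tmul.comp (by fun_prop : Continuous fun x : τ.L2 => (x, k)))
    induction x using τ.denseRange_toL2.induction_on with
    | hp => exact (Submodule.isClosed_topologicalClosure _).preimage hcont
    | ih a => exact Submodule.le_topologicalClosure _ ⟨a ⊗ₜ k, toL2Tensor_tmul τ V a k⟩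
  intro ζ
  change ζ ∈ (W : Set _)
  induction ζ using UniformSpace.Completion.induction_on with
  | hp => exact Submodule.isClosed_topologicalClosure _
  | ih t =>
    induction t with
    | zero => exact W.zero_mem
    | tmul x k => exact hmem x k
    | add s t hs ht =>
      rw [UniformSpace.Completion.coe_add]
      exact W.add_mem hs ht

theorem denseRange_actionMap (F : R.MatrixFiltration) {τ : R.TracialState}
    {α : HilbertBimodule R R X} (hα : α.IsCentrallyTrivial τ) :
    DenseRange (α.actionMap α.centralVectors) := by
  refine (hα.dense_span F).mono ?_
  rw [← LinearMap.coe_range, SetLike.coe_subset_coe, Submodule.span_le]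
  rintro _ ⟨a, k, hk, rfl⟩
  exact ⟨a ⊗ₜ ⟨k, hk⟩, rfl⟩

theorem norm_actionMap (F : R.MatrixFiltration) (α : HilbertBimodule R R X)
    (v : R ⊗[ℂ] α.centralVectors) :
    ‖α.actionMap α.centralVectors v‖ = ‖toL2Tensor τ α.centralVectors v‖ := by
  have h : ∀ v w, inner ℂ (α.actionMap α.centralVectors v) (α.actionMap α.centralVectors w) =
      inner ℂ (toL2Tensor τ α.centralVectors v) (toL2Tensor τ α.centralVectors w) := by
    intro v w
    induction v with
    | zero => simp
    | add v v' hv hv' => simp only [map_add, inner_add_left, hv, hv']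
    | tmul a k =>
      induction w with
      | zero => simp
      | add w w' hw hw' => simp only [map_add, inner_add_right, hw, hw']
      | tmul b l =>
        rw [actionMap_tmul, actionMap_tmul, toL2Tensor_tmul, toL2Tensor_tmul,
          inner_left_left_central F τ k.2 l.2, UniformSpace.Completion.inner_coe,
          TensorProduct.inner_tmul]
        rfl
  rw [norm_eq_sqrt_re_inner (𝕜 := ℂ), h, ← norm_eq_sqrt_re_inner]

variable {K : Type v} [NormedAddCommGroup K] [InnerProductSpace ℂ K] [CompleteSpace K]
  {S : VonNeumannAlgebra K}

/-- A bimodule over `R ⊗ S` which is centrally trivial for the hyperfinite factor `R` is of the form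
`L²R ⊗ K`. -/
theorem exists_isL2Tensor (F : R.MatrixFiltration)
    (α : HilbertBimodule (R.tensor S) (R.tensor S) X)
    (hα : (α.comap (tmulOneHom R S) fun _ => IsNormalFunctional.comp_tmul_one).IsCentrallyTrivial
      τ) :
    ∃ (K : Type w) (_ : NormedAddCommGroup K) (_ : InnerProductSpace ℂ K) (_ : CompleteSpace K)
      (κ : HilbertBimodule S S K)
      (β : HilbertBimodule (R.tensor S) (R.tensor S) (HilbertTensor τ.L2 K)),
      HilbertBimodule.IsL2Tensor τ κ β ∧ α.IsIsomorphic β := by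
  set γ := α.comap (tmulOneHom R S) fun _ => IsNormalFunctional.comp_tmul_one with hγ
  set δ := α.comap (oneTmulHom R S) fun _ => IsNormalFunctional.comp_one_tmul with hδ
  set V := γ.centralVectors with hV
  have hswap : ∀ (r : R) (s : S), tmul r (1 : S) * tmul (1 : R) s = tmul r s := fun r s => by
    rw [tmul_mul_tmul, mul_one, one_mul]
  have hswap' : ∀ (r : R) (s : S), tmul (1 : R) s * tmul r (1 : S) = tmul r s := fun r s => by
    rw [tmul_mul_tmul, mul_one, one_mul]
  have hll : ∀ (r : R) (s : S) x, α.left (tmul r s) x = γ.left r (δ.left s x) := fun r s x => by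
    rw [← hswap, map_mul]; rfl
  have hll' : ∀ (r : R) (s : S) x, α.left (tmul r s) x = δ.left s (γ.left r x) := fun r s x => by
    rw [← hswap', map_mul]; rfl
  have hrr : ∀ (r : R) (s : S) x, α.right (op (tmul r s)) x =
      δ.right (op s) (γ.right (op r) x) := fun r s x => by
    rw [← hswap, op_mul, map_mul]; rfl
  have hrr' : ∀ (r : R) (s : S) x, α.right (op (tmul r s)) x =
      γ.right (op r) (δ.right (op s) x) := fun r s x => by
    rw [← hswap', op_mul, map_mul]; rfl
  have hlr : ∀ (r : R) (s : S) x, γ.left r (δ.right (op s) x) = δ.right (op s) (γ.left r x) :=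
    fun r s x => α.commute _ _ x
  have hrl : ∀ (r : R) (s : S) x, δ.left s (γ.right (op r) x) = γ.right (op r) (δ.left s x) :=
    fun r s x => α.commute _ _ x
  -- The left and right actions of 1 ⊗ s commute with those of r ⊗ 1, hence preserve the `R`-central
  -- vectors.
  let κ : HilbertBimodule S S V := δ.restrict V
    (fun s x hx r => by rw [← hll, hll', hx r, hrl])
    (fun s x hx r => by
      obtain ⟨s, rfl⟩ := op_surjective s
      rw [hlr, hx r, ← hrr, hrr'])
  obtain ⟨U, hU⟩ := exists_linearIsometryEquiv_of_norm_eq (γ.actionMap V) (toL2Tensor τ V)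
    (denseRange_actionMap F hα) (denseRange_toL2Tensor τ V) (norm_actionMap τ F γ)
  have hUV : ∀ (a : R) (k : V), U (γ.left a k) =
      ((τ.toL2 a ⊗ₜ[ℂ] k : τ.L2 ⊗[ℂ] V) : HilbertTensor τ.L2 V) := fun a k => hU (a ⊗ₜ k)
  -- The vectors U(a k) span a dense subspace, so the tensor formulas need only be verified on them.
  have hext : ∀ T T' : HilbertTensor τ.L2 V →L[ℂ] HilbertTensor τ.L2 V,
      (∀ (a : R) (k : V), T (U (γ.left a k)) = T' (U (γ.left a k))) → T = T' := by
    intro T T' h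
    refine ContinuousLinearMap.coeFn_injective ((denseRange_toL2Tensor τ V).equalizer T.continuous
      T'.continuous (funext fun v => ?_))
    simp only [Function.comp_apply]
    induction v with
    | zero => simp
    | add v w hv hw => simp only [map_add, hv, hw]
    | tmul a k => simpa only [hUV, toL2Tensor_tmul] using h a k
  -- Taking β to be the transported structure makes the isomorphism and normality automatic; what
  -- remains is its value on elementary tensors.
  refine ⟨V, inferInstance, inferInstance, inferInstance, κ, α.transport U, fun r s =>
    ⟨hext _ _ fun a k => ?_, hext _ _ fun a k => ?_⟩, U,
    fun a x => (α.transport_left_apply U a x).symm, fun b x => (α.transport_right_apply U b x).symm⟩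
  · have h : α.left (tmul r s) (γ.left a k) = γ.left (r * a) (κ.left s k) := by
      rw [hll', ← left_mul_apply, ← hll', hll]
      rfl
    refine (α.transport_left_apply U _ _).trans ((congrArg U h).trans ?_)
    rw [hUV, hUV, tensorOp_tmul, τ.leftMul_toL2]
  -- The vector k s is again central, so r can be moved to the left of it: (a k)(r ⊗ s) = a (k s) r
  -- = (a r)(k s).
  · have h : α.right (op (tmul r s)) (γ.left a k) = γ.left (a * r) (κ.right (op s) k) := by
      rw [hrr', ← hlr, ← γ.commute, left_mul_apply]
      exact congrArg (γ.left a) ((κ.right (op s) k).2 r).symm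
    refine (α.transport_right_apply U _ _).trans ((congrArg U h).trans ?_)
    rw [hUV, hUV, tensorOp_tmul, τ.rightMul_toL2]

end L2Tensor

end HilbertBimodule

/-! ### Finite multiples of the trivial bimodule -/

namespace VonNeumannAlgebra.TracialState

variable {H : Type u} [NormedAddCommGroup H] [InnerProductSpace ℂ H] [CompleteSpace H]
  {R : VonNeumannAlgebra H} (τ : R.TracialState)

/-- The canonical map `R ^ n → (L²R) ^ n`. -/
noncomputable def toL2Pi (n : ℕ) : (Fin n → R) →ₗ[ℂ] PiLp 2 (fun _ : Fin n => τ.L2) where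
  toFun a := WithLp.toLp 2 fun i => τ.toL2 (a i)
  map_add' a b := by ext i; exact τ.toL2ₗ.map_add _ _
  map_smul' c a := by ext i; exact τ.toL2ₗ.map_smul c _

theorem toL2Pi_apply (n : ℕ) (a : Fin n → R) (i : Fin n) : τ.toL2Pi n a i = τ.toL2 (a i) := rfl

theorem denseRange_toL2Pi (n : ℕ) : DenseRange (τ.toL2Pi n) :=
  (WithLp.toLp_surjective 2).denseRange.comp
    (DenseRange.piMap fun _ : Fin n => τ.denseRange_toL2) (PiLp.continuous_toLp 2 _)

theorem norm_toL2Pi_star (n : ℕ) (a : Fin n → R) : ‖τ.toL2Pi n (star a)‖ = ‖τ.toL2Pi n a‖ := by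
  rw [← sq_eq_sq₀ (norm_nonneg _) (norm_nonneg _), PiLp.norm_sq_eq_of_L2, PiLp.norm_sq_eq_of_L2]
  exact Finset.sum_congr rfl fun i _ => congrArg (· ^ 2) (τ.norm_toL2_star (a i))

theorem norm_toL2_one : ‖τ.toL2 1‖ = 1 := by
  refine (sq_eq_sq₀ (norm_nonneg _) zero_le_one).mp (Complex.ofReal_injective ?_)
  push_cast
  rw [norm_toL2_sq, star_one, one_mul, τ.map_one, one_pow]

/-- Traciality moves a to the right action. This lets right linear maps be pulled out of such inner
products in `card_le_of_orthonormal`. -/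
theorem inner_toL2_left (a : R) (v : τ.L2) :
    inner ℂ (τ.toL2 a) v = inner ℂ (τ.toL2 1) (τ.rightMul (star a) v) := by
  induction v using τ.denseRange_toL2.induction_on with
  | hp => exact isClosed_eq (by fun_prop) (by fun_prop)
  | ih x => rw [rightMul_toL2, inner_toL2, inner_toL2, star_one, one_mul, τ.tracial]

/-- The norm bound on the sequence carries the convergence from the dense image of `R` to all of
L²R. -/
theorem IsCentralSequence.tendsto {τ : R.TracialState} {x : ℕ → R} (hx : τ.IsCentralSequence x)
    (v : τ.L2) : Tendsto (fun n => τ.leftMul (x n) v - τ.rightMul (x n) v) atTop (𝓝 0) := by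
  obtain ⟨⟨C, hC⟩, hx⟩ := hx
  have hC0 : 0 ≤ C := (norm_nonneg _).trans (hC 0)
  rw [Metric.tendsto_atTop]
  intro ε hε
  obtain ⟨m, hm⟩ := Metric.denseRange_iff.mp τ.denseRange_toL2 v (ε / (2 * (2 * C + 1)))
    (by positivity)
  obtain ⟨N, hN⟩ := Metric.tendsto_atTop.mp (hx m) (ε / 2) (half_pos hε)
  refine ⟨N, fun n hn => ?_⟩
  have h1 := hN n hn
  rw [dist_zero_right, norm_norm, toL2_sub, ← leftMul_toL2, ← rightMul_toL2] at h1
  rw [dist_eq_norm] at hm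
  rw [dist_zero_right]
  set w := v - τ.toL2 m with hw
  have hv : τ.leftMul (x n) v - τ.rightMul (x n) v = (τ.leftMul (x n) w - τ.rightMul (x n) w) +
      (τ.leftMul (x n) (τ.toL2 m) - τ.rightMul (x n) (τ.toL2 m)) := by
    rw [hw, map_sub, map_sub]
    abel
  rw [hv]
  calc _ ≤ (C * ‖w‖ + C * ‖w‖) + ‖τ.leftMul (x n) (τ.toL2 m) - τ.rightMul (x n) (τ.toL2 m)‖ := by
        refine (norm_add_le _ _).trans (add_le_add_left ((norm_sub_le _ _).trans
          (add_le_add ?_ ?_)) _)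
        · exact (τ.norm_leftMul_apply_le _ _).trans (by gcongr; exact hC n)
        · exact (τ.norm_rightMul_apply_le _ _).trans (by gcongr; exact hC n)
    _ ≤ (2 * C + 1) * ‖w‖ + ‖τ.leftMul (x n) (τ.toL2 m) - τ.rightMul (x n) (τ.toL2 m)‖ := by
        nlinarith [norm_nonneg w]
    _ < (2 * C + 1) * (ε / (2 * (2 * C + 1))) + ε / 2 := by gcongr
    _ = ε := by field_simp; ring

end VonNeumannAlgebra.TracialState

namespace HilbertBimodule

open VonNeumannAlgebra

variable {H : Type u} [NormedAddCommGroup H] [InnerProductSpace ℂ H] [CompleteSpace H]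
  {R : VonNeumannAlgebra H} {τ : R.TracialState}
  {X : Type w} [NormedAddCommGroup X] [InnerProductSpace ℂ X] [CompleteSpace X]
  {α : HilbertBimodule R R X} {n : ℕ}

/-! ### Finite multiples of L²R are objects of χ̃(R). -/

theorem IsMultipleOfL2.isRightFinite (h : α.IsMultipleOfL2 τ n) : α.IsRightFinite τ := by
  obtain ⟨U, -, hU⟩ := h
  exact ⟨n, U.toLinearIsometry, hU⟩

theorem IsMultipleOfL2.isCentrallyTrivial (h : α.IsMultipleOfL2 τ n) :
    α.IsCentrallyTrivial τ := by
  obtain ⟨U, hl, hr⟩ := h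
  intro a ha x
  have h1 : Tendsto (fun n => U (α.left (a n) x - α.right (op (a n)) x)) atTop (𝓝 0) := by
    have h2 : Tendsto (fun n i => τ.leftMul (a n) (U x i) - τ.rightMul (a n) (U x i)) atTop
        (𝓝 (0 : Fin n → τ.L2)) := tendsto_pi_nhds.mpr fun i => ha.tendsto (U x i)
    convert! ((PiLp.continuous_toLp 2 (fun _ : Fin n => τ.L2)).tendsto 0).comp h2 using 1
    ext m i
    rw [map_sub]
    exact congrArg₂ (· - ·) (hl _ _ _) (hr _ _ _)
  simpa only [U.norm_map, norm_zero] using h1.norm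

/-- The coordinate inclusions, taken as a constant sequence, form an exact basis: their adjoints are
the coordinate projections, and the images of 1 are central vectors. -/
theorem IsMultipleOfL2.isApproximatelyInner (h : α.IsMultipleOfL2 τ n) :
    α.IsApproximatelyInner τ := by
  obtain ⟨U, hl, hr⟩ := h
  let P : Fin n → τ.L2 →L[ℂ] PiLp 2 (fun _ : Fin n => τ.L2) := fun i =>
    (PiLp.continuousLinearEquiv 2 ℂ (fun _ : Fin n => τ.L2)).symm.toContinuousLinearMap ∘L
      ContinuousLinearMap.single ℂ (fun _ : Fin n => τ.L2) i
  have hP : ∀ i v j, P i v j = if j = i then v else 0 := by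
    intro i v j
    change Pi.single (M := fun _ : Fin n => τ.L2) i v j = _
    rw [Pi.single_apply]
  have hPmod : ∀ (T : τ.L2 →L[ℂ] τ.L2) i v j, P i (T v) j = T (P i v j) := by
    intro T i v j
    rw [hP, hP]
    split_ifs <;> simp
  let L : Fin n → τ.L2 →L[ℂ] X := fun i => U.symm.toContinuousLinearEquiv.toContinuousLinearMap ∘L P i
  have hL : ∀ i v, U (L i v) = P i v := fun i v => U.apply_symm_apply _
  have hadj : ∀ i x, ContinuousLinearMap.adjoint (L i) x = U x i := by
    intro i x
    refine ext_inner_left ℂ fun v => ?_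
    rw [ContinuousLinearMap.adjoint_inner_right, ← U.inner_map_map, hL, PiLp.inner_apply,
      Finset.sum_eq_single i (fun j _ hj => by rw [hP, if_neg hj, inner_zero_left]) (by simp), hP,
      if_pos rfl]
  refine ⟨n, fun _ => L, fun _ i a v => U.injective ?_, ⟨∑ i, ‖L i‖, fun _ i => ?_⟩, fun x => ?_,
    fun a i => ?_⟩
  · rw [hL]
    ext j
    rw [hr, hL, hPmod]
  · exact Finset.single_le_sum (f := fun i => ‖L i‖) (fun i _ => norm_nonneg (L i)) (Finset.mem_univ i)
  · refine tendsto_const_nhds.congr fun _ => U.injective ?_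
    ext j
    simp only [hadj, map_sum, hL]
    rw [WithLp.ofLp_sum, Finset.sum_apply, Finset.sum_eq_single j
      (fun i _ hi => by rw [hP, if_neg hi.symm]) (by simp), hP, if_pos rfl]
  · refine tendsto_const_nhds.congr fun _ => ?_
    rw [eq_comm, norm_eq_zero, sub_eq_zero]
    refine U.injective ?_
    ext j
    rw [hl, hr, hL, ← hPmod, ← hPmod, τ.leftMul_toL2, τ.rightMul_toL2, one_mul, mul_one]

/-- By traciality a ↦ a* is a conjugate-linear isometry in each coordinate, and it exchanges the
left and right actions; followed by U⁻¹ it is a linear map into the conjugate space. -/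
theorem IsMultipleOfL2.conj (h : α.IsMultipleOfL2 τ n) : α.conj.IsMultipleOfL2 τ n := by
  obtain ⟨U, hl, hr⟩ := h
  let f : (Fin n → R) →ₗ[ℂ] ConjSpace X :=
    { toFun := fun a => ConjSpace.of (U.symm (τ.toL2Pi n (star a)))
      map_add' := fun a b => by rw [star_add, map_add, map_add, map_add]
      map_smul' := fun c a => by
        rw [star_smul, map_smul, map_smul, ConjSpace.of_smul, RingHom.id_apply]
        simp }
  have hf : ∀ a, f a = ConjSpace.of (U.symm (τ.toL2Pi n (star a))) := fun a => rfl
  have hdense : DenseRange f := by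
    have h1 : DenseRange (τ.toL2Pi n ∘ star) := by
      rw [DenseRange, star_involutive.surjective.range_comp]
      exact τ.denseRange_toL2Pi n
    exact U.symm.surjective.denseRange.comp h1 U.symm.continuous
  have hnorm : ∀ a, ‖f a‖ = ‖τ.toL2Pi n a‖ := fun a =>
    (U.symm.norm_map _).trans (τ.norm_toL2Pi_star n a)
  obtain ⟨W, hW⟩ := exists_linearIsometryEquiv_of_norm_eq f (τ.toL2Pi n) hdense
    (τ.denseRange_toL2Pi n) hnorm
  refine ⟨W, fun a x i => ?_, fun a x i => ?_⟩
  · refine hdense.induction_on (p := fun x => W (α.conj.left a x) i = τ.leftMul a (W x i)) x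
      (isClosed_eq (by fun_prop) (by fun_prop)) fun b => ?_
    have h1 : α.conj.left a (f b) = f fun i => a * b i := by
      change ConjSpace.of (α.right (op (star a)) (U.symm (τ.toL2Pi n (star b)))) = _
      rw [hf]
      refine congrArg _ (U.injective ?_)
      ext j
      rw [hr, U.apply_symm_apply, U.apply_symm_apply, τ.toL2Pi_apply, τ.toL2Pi_apply,
        τ.rightMul_toL2]
      simp
    rw [h1, hW, hW, τ.toL2Pi_apply, τ.toL2Pi_apply, τ.leftMul_toL2]
  · refine hdense.induction_on (p := fun x => W (α.conj.right (op a) x) i = τ.rightMul a (W x i)) x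
      (isClosed_eq (by fun_prop) (by fun_prop)) fun b => ?_
    have h1 : α.conj.right (op a) (f b) = f fun i => b i * a := by
      change ConjSpace.of (α.left (star a) (U.symm (τ.toL2Pi n (star b)))) = _
      rw [hf]
      refine congrArg _ (U.injective ?_)
      ext j
      rw [hl, U.apply_symm_apply, U.apply_symm_apply, τ.toL2Pi_apply, τ.toL2Pi_apply,
        τ.leftMul_toL2]
      simp
    rw [h1, hW, hW, τ.toL2Pi_apply, τ.toL2Pi_apply, τ.rightMul_toL2]

theorem IsMultipleOfL2.memChiTilde (h : α.IsMultipleOfL2 τ n) : α.MemChiTilde τ :=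
  ⟨⟨h.isRightFinite, h.conj.isRightFinite⟩, ⟨h.isApproximatelyInner, h.conj.isApproximatelyInner⟩,
    h.isCentrallyTrivial, h.conj.isCentrallyTrivial⟩

/-! ### Central triviality and right finiteness give a finite multiple of L²R. -/

/-- The map `a ↦ ∑ i, a i k i`. -/
noncomputable def actionSum (α : HilbertBimodule R R X) (k : Fin n → X) :
    (Fin n → R) →ₗ[ℂ] X where
  toFun a := ∑ i, α.left (a i) (k i)
  map_add' a b := by simp [Finset.sum_add_distrib]
  map_smul' c a := by simp [Finset.smul_sum]

/-- Since ⟪a_i k_i, a_j k_j⟫ = τ(a_i* a_j)⟪k_i, k_j⟫, orthonormality kills the cross terms. -/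
theorem norm_actionSum (F : R.MatrixFiltration) {k : Fin n → X}
    (hk : ∀ i, k i ∈ α.centralVectors) (ho : Orthonormal ℂ k) (a : Fin n → R) :
    ‖α.actionSum k a‖ = ‖τ.toL2Pi n a‖ := by
  have h : inner ℂ (α.actionSum k a) (α.actionSum k a) =
      inner ℂ (τ.toL2Pi n a) (τ.toL2Pi n a) := by
    change inner ℂ (∑ i, α.left (a i) (k i)) (∑ i, α.left (a i) (k i)) = _
    rw [sum_inner, PiLp.inner_apply]
    refine Finset.sum_congr rfl fun i _ => ?_
    rw [inner_sum, Finset.sum_eq_single i]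
    · rw [inner_left_left_central F τ (hk i) (hk i), orthonormal_iff_ite.mp ho, if_pos rfl, mul_one]
      rfl
    · intro j _ hj
      rw [inner_left_left_central F τ (hk i) (hk j), orthonormal_iff_ite.mp ho, if_neg hj.symm,
        mul_zero]
    · simp
  rw [norm_eq_sqrt_re_inner (𝕜 := ℂ), h, ← norm_eq_sqrt_re_inner]

/-- The dimension of the space of central vectors is bounded by the number of generators of the
right module. -/
theorem card_le_of_orthonormal (F : R.MatrixFiltration) {m : ℕ}
    (V : X →ₗᵢ[ℂ] PiLp 2 (fun _ : Fin n => τ.L2))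
    (hV : ∀ (a : R) (x : X) (i : Fin n), V (α.right (op a) x) i = τ.rightMul a (V x i))
    {k : Fin m → X} (hk : ∀ i, k i ∈ α.centralVectors) (ho : Orthonormal ℂ k) : m ≤ n := by
  -- The numbers ‖V(k_j)_i‖² form an n × m array with row sums at most 1 and column sums 1; summing
  -- in both orders gives m ≤ n.
  have hrow : ∀ i, ∑ j, ‖V (k j) i‖ ^ 2 ≤ 1 := by
    intro i
    have hbound : ∀ w : PiLp 2 (fun _ : Fin m => τ.L2),
        ‖∑ j, inner ℂ (w j) (V (k j) i)‖ ≤ ‖w‖ := by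
      intro w
      induction w using (τ.denseRange_toL2Pi m).induction_on with
      | hp => exact isClosed_le (by fun_prop) (by fun_prop)
      | ih a =>
        -- Since k_j a_j* = a_j* k_j, right linearity of V collects the sum into the single vector
        -- V(Σ_j a_j* k_j), whose norm `norm_actionSum` computes.
        have h1 : ∑ j, inner ℂ (τ.toL2Pi m a j) (V (k j) i) =
            inner ℂ (τ.toL2 1) (V (α.actionSum k (star a)) i) := by
          change _ = inner ℂ (τ.toL2 1) (V (∑ j, α.left (star (a j)) (k j)) i)
          rw [map_sum, WithLp.ofLp_sum, Finset.sum_apply, inner_sum]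
          refine Finset.sum_congr rfl fun j _ => ?_
          rw [τ.toL2Pi_apply, τ.inner_toL2_left, hk j, hV]
        rw [h1]
        calc _ ≤ ‖τ.toL2 1‖ * ‖V (α.actionSum k (star a)) i‖ := norm_inner_le_norm _ _
          _ ≤ 1 * ‖V (α.actionSum k (star a))‖ := by
            rw [τ.norm_toL2_one]
            gcongr
            exact PiLp.norm_apply_le _ i
          _ = ‖τ.toL2Pi m a‖ := by
            rw [one_mul, V.norm_map, norm_actionSum (τ := τ) F hk ho, τ.norm_toL2Pi_star]
    -- Testing the bound on the row itself gives ‖w‖² ≤ ‖w‖, hence ‖w‖ ≤ 1.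
    set w : PiLp 2 (fun _ : Fin m => τ.L2) := WithLp.toLp 2 fun j => V (k j) i with hw
    have h1 := hbound w
    have h2 : ∑ j, inner ℂ (w j) (V (k j) i) = ((‖w‖ ^ 2 : ℝ) : ℂ) := by
      rw [PiLp.norm_sq_eq_of_L2]
      push_cast
      exact Finset.sum_congr rfl fun j _ => inner_self_eq_norm_sq_to_K _
    rw [h2, Complex.norm_real, Real.norm_of_nonneg (sq_nonneg _)] at h1
    have h3 : ‖w‖ ^ 2 = ∑ j, ‖V (k j) i‖ ^ 2 := PiLp.norm_sq_eq_of_L2 _ _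
    rw [← h3]
    nlinarith [norm_nonneg w]
  have hcol : ∀ j, ∑ i, ‖V (k j) i‖ ^ 2 = 1 := fun j => by
    rw [← PiLp.norm_sq_eq_of_L2, V.norm_map, ho.1 j, one_pow]
  have : (m : ℝ) ≤ n := by
    calc (m : ℝ) = ∑ j : Fin m, ∑ i, ‖V (k j) i‖ ^ 2 := by simp [hcol]
      _ = ∑ i : Fin n, ∑ j, ‖V (k j) i‖ ^ 2 := Finset.sum_comm
      _ ≤ ∑ i : Fin n, (1 : ℝ) := Finset.sum_le_sum fun i _ => hrow i
      _ = n := by simp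
  exact_mod_cast this

/-- A centrally trivial bimodule over the hyperfinite factor which is finitely generated as a right
module is a finite multiple of the trivial bimodule. -/
theorem IsCentrallyTrivial.exists_isMultipleOfL2 (F : R.MatrixFiltration)
    (hα : α.IsCentrallyTrivial τ) (hfin : α.IsRightFinite τ) : ∃ n, α.IsMultipleOfL2 τ n := by
  obtain ⟨n, V, hV⟩ := hfin
  obtain ⟨w, b, -⟩ := exists_hilbertBasis ℂ α.centralVectors
  have hcoe : Orthonormal ℂ fun i => (b i : X) :=
    b.orthonormal.comp_linearIsometry α.centralVectors.subtypeₗᵢ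
  have hfinite : Finite w := by
    by_contra hinf
    rw [not_finite_iff_infinite] at hinf
    -- An infinite basis would contain n + 1 orthonormal central vectors, one more than the
    -- embedding into n copies of L²R permits.
    let e : Fin (n + 1) ↪ w := Fin.valEmbedding.trans (Infinite.natEmbedding w)
    have := card_le_of_orthonormal F V hV (fun i => (b (e i)).2) (hcoe.comp e e.injective)
    omega
  obtain ⟨m, ⟨e⟩⟩ := Finite.exists_equiv_fin w
  set k : Fin m → X := fun i => (b (e.symm i) : X) with hkdef
  have hk : ∀ i, k i ∈ α.centralVectors := fun i => (b (e.symm i)).2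
  have ho : Orthonormal ℂ k := hcoe.comp e.symm e.symm.injective
  set W := (LinearMap.range (α.actionSum k)).topologicalClosure with hW
  have hsingle : ∀ (a : R) (i : Fin m), α.left a (k i) ∈ W := by
    intro a i
    refine Submodule.le_topologicalClosure _ ⟨Pi.single i a, ?_⟩
    change ∑ j, α.left ((Pi.single i a : Fin m → R) j) (k j) = _
    rw [Finset.sum_eq_single i (fun j _ hj => by rw [Pi.single_eq_of_ne hj, map_zero]; rfl)
      (by simp), Pi.single_eq_same]
  have hall : ∀ (a : R) (x : α.centralVectors), α.left a x ∈ W := by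
    intro a x
    -- Left multiplication by a is continuous, so it suffices to treat the basis vectors.
    have hx : x ∈ (Submodule.span ℂ (Set.range b)).topologicalClosure := by
      rw [b.dense_span]; trivial
    have hle : (Submodule.span ℂ (Set.range b)).topologicalClosure ≤
        W.comap ((α.left a).toLinearMap ∘ₗ α.centralVectors.subtype) := by
      refine Submodule.topologicalClosure_minimal _ (Submodule.span_le.mpr ?_) ?_
      · rintro _ ⟨i, rfl⟩
        have := hsingle a (e i)
        simpa [hkdef] using this
      · exact (Submodule.isClosed_topologicalClosure _).preimage
          ((α.left a).continuous.comp continuous_subtype_val)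
    exact hle hx
  have hdense : DenseRange (α.actionSum k) := by
    intro x
    have h1 : (Submodule.span ℂ {v | ∃ a : R, ∃ k ∈ α.centralVectors, v = α.left a k}) ≤ W := by
      rw [Submodule.span_le]
      rintro _ ⟨a, y, hy, rfl⟩
      exact hall a ⟨y, hy⟩
    exact closure_minimal h1 (Submodule.isClosed_topologicalClosure _) (hα.dense_span F x)
  obtain ⟨U, hU⟩ := exists_linearIsometryEquiv_of_norm_eq (α.actionSum k) (τ.toL2Pi m) hdense
    (τ.denseRange_toL2Pi m) (norm_actionSum F hk ho)
  refine ⟨m, U, fun a x i => ?_, fun a x i => ?_⟩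
  · refine hdense.induction_on (p := fun x => U (α.left a x) i = τ.leftMul a (U x i)) x
      (isClosed_eq (by fun_prop) (by fun_prop)) fun c => ?_
    have h1 : α.left a (α.actionSum k c) = α.actionSum k fun i => a * c i := by
      change α.left a (∑ i, α.left (c i) (k i)) = ∑ i, α.left (a * c i) (k i)
      simp only [map_sum, left_mul_apply]
    rw [h1, hU, hU, τ.toL2Pi_apply, τ.toL2Pi_apply, τ.leftMul_toL2]
  · refine hdense.induction_on (p := fun x => U (α.right (op a) x) i = τ.rightMul a (U x i)) x
      (isClosed_eq (by fun_prop) (by fun_prop)) fun c => ?_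
    have h1 : α.right (op a) (α.actionSum k c) = α.actionSum k fun i => c i * a := by
      change α.right (op a) (∑ i, α.left (c i) (k i)) = ∑ i, α.left (c i * a) (k i)
      rw [map_sum]
      exact Finset.sum_congr rfl fun i _ => by rw [← α.commute, ← hk i, left_mul_apply]
    rw [h1, hU, hU, τ.toL2Pi_apply, τ.toL2Pi_apply, τ.rightMul_toL2]

end HilbertBimodule

theorem mainTheorem8 {HR : Type u} [NormedAddCommGroup HR] [InnerProductSpace ℂ HR]
    [CompleteSpace HR] (R : VonNeumannAlgebra HR) (hR : R.IsHyperfiniteII1Factor)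
    (τ : R.TracialState) :
    (∀ {HS : Type v} [NormedAddCommGroup HS] [InnerProductSpace ℂ HS] [CompleteSpace HS]
      (S : VonNeumannAlgebra HS) (_ : S.IsFactor)
      {X : Type w} [NormedAddCommGroup X] [InnerProductSpace ℂ X] [CompleteSpace X]
      [TopologicalSpace.SeparableSpace X]
      (α : HilbertBimodule (R.tensor S) (R.tensor S) X),
      (∀ x : ℕ → R, τ.IsCentralSequence x → ∀ ξ : X,
        Tendsto (fun n => ‖α.left (VonNeumannAlgebra.tmul (x n) (1 : S)) ξ -
          α.right (op (VonNeumannAlgebra.tmul (x n) (1 : S))) ξ‖) atTop (𝓝 0)) →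
      ∃ (K : Type w) (_ : NormedAddCommGroup K) (_ : InnerProductSpace ℂ K) (_ : CompleteSpace K)
        (κ : HilbertBimodule S S K)
        (β : HilbertBimodule (R.tensor S) (R.tensor S) (HilbertTensor τ.L2 K)),
        HilbertBimodule.IsL2Tensor τ κ β ∧ α.IsIsomorphic β) ∧
    (∀ {X : Type w} [NormedAddCommGroup X] [InnerProductSpace ℂ X] [CompleteSpace X]
      (α : HilbertBimodule R R X), α.MemChiTilde τ ↔ ∃ n : ℕ, α.IsMultipleOfL2 τ n) := by
  obtain ⟨F⟩ := hR.nonempty_matrixFiltration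
  refine ⟨fun S _ X _ _ _ _ α hα => HilbertBimodule.exists_isL2Tensor τ F α hα, fun α =>
    ⟨fun h => h.2.2.1.exists_isMultipleOfL2 F h.1.1, fun ⟨_, h⟩ => h.memChiTilde⟩⟩
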